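/- Conventions. A Kähler metric on a complex manifold $(M,J)$ is a smooth $J$-invariant Riemannian metric $g$ whose fundamental form $\omega=g(J\cdot,\cdot)$ is closed; one then calls $(M,g,\omega)$ a Kähler manifold. A Killing potential for $g$ is a smooth real function $h$ on $M$ such that $J\,\mathrm{grad}_g h$ is a Killing vector field of $g$. For a smooth real function $f$ on $M$ and $\nu\in\mathbb R$, the $(f,\nu)$ scalar curvature of $g$ is $$\mathit{Scal}_{f,\nu}(g)=f^2\,\mathit{Scal}(g)-2(\nu-1)\,f\,\Delta_g f-\nu(\nu-1)\,|df|_g^2,$$ where $\mathit{Scal}(g)$ is the scalar curvature and $\Delta_g=-\operatorname{div}_g\operatorname{grad}_g$ is the Riemannian Laplacian. If $f$ is a Killing potential for the Kähler metric $g$, then $g$ is called $(f,\nu)$-extremal if $\mathit{Scal}_{f,\nu}(g)$ is also a Killing potential for $g$. Proposition. Let $(V,g_V,\omega_V)$ be a flat Kähler manifold (finite-dimensional, with vanishing Riemann curvature tensor), and let $f>0$ be a Killing potential on $V$. Let $(B,g_B,\omega_B)$ be a finite-dimensional Kähler manifold with vanishing scalar curvature. Then, for every $\nu\in\mathbb R$,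 the Kähler product $(V\times B,\ g_V+g_B,\ \omega_V+\omega_B)$, with the product complex structure, is a Kähler manifold and is $(f,\nu)$-extremal, where $f$ is regarded as a function on $V\times B$ by pull-back from $V$. -/

import Mathlib

open scoped Manifold ContDiff

set_option maxSynthPendingDepth 3

noncomputable section

/-! ## Riemannian geometry in local coordinates

Here `E` is a finite-dimensional real vector space, and `G : E → E →L[ℝ] E →L[ℝ] ℝ` gives the
coefficients of a Riemannian metric on an open subset of `E`. -/

namespace LocalRiem

variable {E : Type*} [NormedAddCommGroup E] [NormedSpace ℝ E]

/-- Raising an index: for a nondegenerate bilinear form `b`, the vector `sharp b α` is determined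
by `b (sharp b α) w = α w` for all `w`. -/
def sharp (b : E →L[ℝ] E →L[ℝ] ℝ) : (E →L[ℝ] ℝ) →L[ℝ] E :=
  ContinuousLinearMap.inverse b

/-- The Christoffel symbols of the first kind,
`Γ₁(u, v, w) = (∂_u G(v, w) + ∂_v G(u, w) - ∂_w G(u, v)) / 2`. -/
def christoffelFirst (G : E → E →L[ℝ] E →L[ℝ] ℝ) (y : E) : E →L[ℝ] E →L[ℝ] E →L[ℝ] ℝ :=
  let D : E →L[ℝ] E →L[ℝ] E →L[ℝ] ℝ := fderiv ℝ G y
  let flipMap : (E →L[ℝ] E →L[ℝ] ℝ) →L[ℝ] (E →L[ℝ] E →L[ℝ] ℝ) :=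
    (ContinuousLinearMap.flipₗᵢ ℝ E E ℝ).toContinuousLinearEquiv.toContinuousLinearMap
  (1 / 2 : ℝ) • (D + D.flip - flipMap.comp D.flip)

theorem christoffelFirst_apply (G : E → E →L[ℝ] E →L[ℝ] ℝ) (y u v w : E) :
    christoffelFirst G y u v w
      = (fderiv ℝ G y u v w + fderiv ℝ G y v u w - fderiv ℝ G y w u v) / 2 := by
  simp [christoffelFirst]
  ring

/-- The Christoffel symbols `Γ(u, v)` of the Levi-Civita connection: for constant vector fields
`u`, `v` this is `∇_u v`. -/
def christoffel (G : E → E →L[ℝ] E →L[ℝ] ℝ) (y : E) : E →L[ℝ] E →L[ℝ] E :=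
  (ContinuousLinearMap.compL ℝ E (E →L[ℝ] ℝ) E (sharp (G y))).comp (christoffelFirst G y)

theorem christoffel_apply (G : E → E →L[ℝ] E →L[ℝ] ℝ) (y u v : E) :
    christoffel G y u v = sharp (G y) (christoffelFirst G y u v) := rfl

/-- The Riemann curvature tensor `R(u, v) w = ∇_u ∇_v w - ∇_v ∇_u w` (for constant vector fields
`u`, `v`, `w`), as the linear map `u ↦ R(u, v) w`. -/
def curvature (G : E → E →L[ℝ] E →L[ℝ] ℝ) (y v w : E) : E →ₗ[ℝ] E where
  toFun u := fderiv ℝ (christoffel G) y u v w - fderiv ℝ (christoffel G) y v u w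
    + christoffel G y u (christoffel G y v w) - christoffel G y v (christoffel G y u w)
  map_add' a b := by simp only [map_add, add_apply]; abel
  map_smul' c a := by
    simp only [map_smul, smul_apply, RingHom.id_apply, smul_add, smul_sub]

/-- The Ricci tensor, `Ric(v, w) = tr (u ↦ R(u, v) w)`. -/
def ricci (G : E → E →L[ℝ] E →L[ℝ] ℝ) (y : E) : E →ₗ[ℝ] E →ₗ[ℝ] ℝ :=
  LinearMap.mk₂ ℝ (fun v w => LinearMap.trace ℝ E (curvature G y v w))
    (fun a b w => by
      rw [← map_add]; congr 1; ext u
      simp only [curvature, LinearMap.coe_mk, AddHom.coe_mk, LinearMap.add_apply, map_add,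
        add_apply]
      abel)
    (fun c a w => by
      rw [← map_smul]; congr 1; ext u
      simp only [curvature, LinearMap.coe_mk, AddHom.coe_mk, LinearMap.smul_apply, map_smul,
        smul_apply, smul_add, smul_sub])
    (fun v a b => by
      rw [← map_add]; congr 1; ext u
      simp only [curvature, LinearMap.coe_mk, AddHom.coe_mk, LinearMap.add_apply, map_add]
      abel)
    (fun c v a => by
      rw [← map_smul]; congr 1; ext u
      simp only [curvature, LinearMap.coe_mk, AddHom.coe_mk, LinearMap.smul_apply, map_smul,
        smul_add, smul_sub])

/-- The trace of a bilinear form `T` with respect to a metric `b`, `b^{ij} T_{ij}`. -/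
def metricTrace [FiniteDimensional ℝ E] (b : E →L[ℝ] E →L[ℝ] ℝ) (T : E →ₗ[ℝ] E →ₗ[ℝ] ℝ) : ℝ :=
  LinearMap.trace ℝ E
    ((sharp b).toLinearMap ∘ₗ
      (LinearMap.toContinuousLinearMap : (E →ₗ[ℝ] ℝ) ≃ₗ[ℝ] (E →L[ℝ] ℝ)).toLinearMap ∘ₗ T)

/-- The scalar curvature, the metric trace of the Ricci tensor. -/
def scal [FiniteDimensional ℝ E] (G : E → E →L[ℝ] E →L[ℝ] ℝ) (y : E) : ℝ :=
  metricTrace (G y) (ricci G y)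

/-- The Hessian `(∇ dh)(u, v) = ∂_u ∂_v h - dh (Γ(u, v))`. -/
def hessian (G : E → E →L[ℝ] E →L[ℝ] ℝ) (h : E → ℝ) (y : E) : E →L[ℝ] E →L[ℝ] ℝ :=
  fderiv ℝ (fderiv ℝ h) y
    - (ContinuousLinearMap.compL ℝ E E ℝ (fderiv ℝ h y)).comp (christoffel G y)

theorem hessian_apply (G : E → E →L[ℝ] E →L[ℝ] ℝ) (h : E → ℝ) (y u v : E) :
    hessian G h y u v
      = fderiv ℝ (fderiv ℝ h) y u v - fderiv ℝ h y (christoffel G y u v) := rfl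

/-- The Riemannian Laplacian with nonnegative spectrum, `Δ h = - div grad h = - tr_G (∇ dh)`. -/
def laplacian [FiniteDimensional ℝ E] (G : E → E →L[ℝ] E →L[ℝ] ℝ) (h : E → ℝ) (y : E) : ℝ :=
  - metricTrace (G y) ((ContinuousLinearMap.coeLM ℝ).comp (hessian G h y).toLinearMap)

end LocalRiem

/-! ## Kähler metrics on complex manifolds

`M` is a complex manifold modelled on the finite-dimensional complex vector space `E` through a
model `I` over `ℂ` without boundary (in the theorem, `𝓘(ℂ, E)`, or a product of two such). Its
real tangent space at `x` is `TangentSpace I x`, regarded as a real vector space, and its complex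
structure `J` is multiplication by `Complex.I`. The coordinates defined by `e ∈ atlas H M` are
`e.extend I`. -/

namespace Kahler

variable {E : Type*} [NormedAddCommGroup E] [NormedSpace ℂ E] {H : Type*} [TopologicalSpace H]
  (I : ModelWithCorners ℂ E H) (M : Type*) [TopologicalSpace M] [ChartedSpace H M]

/-- Fields of real bilinear forms on the tangent spaces of `M`. -/
abbrev BilinField : Type _ :=
  ∀ x : M, TangentSpace I x →L[ℝ] TangentSpace I x →L[ℝ] ℝ

variable {I M}

/-- The complex structure `J` on the tangent space at `x`. -/
def J (x : M) : TangentSpace I x →L[ℝ] TangentSpace I x :=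
  (Complex.I • ContinuousLinearMap.id ℝ E : E →L[ℝ] E)

/-- The coefficients of a field of bilinear forms in the coordinates `e.extend I`: the
pull-back by the inverse of the chart. -/
def coordBilin (T : BilinField I M) (e : OpenPartialHomeomorph M H) (y : E) :
    E →L[ℝ] E →L[ℝ] ℝ :=
  let D : E →L[ℂ] E := mfderiv 𝓘(ℂ, E) I (e.extend I).symm y
  (T ((e.extend I).symm y) : E →L[ℝ] E →L[ℝ] ℝ).bilinearComp (D.restrictScalars ℝ)
    (D.restrictScalars ℝ)

/-- The components of a vector field in the coordinates `e.extend I`. -/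
def coordVec (X : ∀ x : M, TangentSpace I x) (e : OpenPartialHomeomorph M H) (y : E) : E :=
  mfderiv I 𝓘(ℂ, E) (e.extend I) ((e.extend I).symm y) (X ((e.extend I).symm y))

variable (I) in
/-- A function in the coordinates `e.extend I`. -/
def coordFun (h : M → ℝ) (e : OpenPartialHomeomorph M H) (y : E) : ℝ :=
  h ((e.extend I).symm y)

/-- The fundamental 2-form `ω(u, v) = g(J u, v)`. -/
def kahlerForm (g : BilinField I M) : BilinField I M :=
  fun x => (g x).comp (J x)

/-- `g` is a Kähler metric: a smooth Riemannian metric, invariant under `J`, whose fundamental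
form `ω` is closed,
`dω(u, v, w) = ∂_u ω(v, w) + ∂_v ω(w, u) + ∂_w ω(u, v) = 0` in all charts. -/
structure IsKahler (g : BilinField I M) : Prop where
  symm : ∀ (x : M) (u v : TangentSpace I x), g x u v = g x v u
  pos : ∀ (x : M) (u : TangentSpace I x), u ≠ 0 → 0 < g x u u
  smooth : ∀ e ∈ atlas H M, ContDiffOn ℝ ∞ (coordBilin g e) (e.extend I).target
  hermitian : ∀ (x : M) (u v : TangentSpace I x), g x (J x u) (J x v) = g x u v
  closed : ∀ e ∈ atlas H M, ∀ y ∈ (e.extend I).target, ∀ u v w : E,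
    fderiv ℝ (coordBilin (kahlerForm g) e) y u v w
      + fderiv ℝ (coordBilin (kahlerForm g) e) y v w u
      + fderiv ℝ (coordBilin (kahlerForm g) e) y w u v = 0

/-- `X` is a Killing vector field of `g`: a smooth vector field with `L_X g = 0`, where in
coordinates `(L_X g)(u, v) = ∂_X g(u, v) + g(∂_u X, v) + g(u, ∂_v X)`. -/
structure IsKilling (g : BilinField I M) (X : ∀ x : M, TangentSpace I x) : Prop where
  smooth : ∀ e ∈ atlas H M, ContDiffOn ℝ ∞ (coordVec X e) (e.extend I).target
  lie_eq_zero : ∀ e ∈ atlas H M, ∀ y ∈ (e.extend I).target, ∀ u v : E,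
    fderiv ℝ (coordBilin g e) y (coordVec X e y) u v
      + coordBilin g e y (fderiv ℝ (coordVec X e) y u) v
      + coordBilin g e y u (fderiv ℝ (coordVec X e) y v) = 0

/-- The real differential of `h` at `x` (the tangent space at `x` is identified with `E` by the
preferred chart at `x`). -/
def differential (h : M → ℝ) (x : M) : TangentSpace I x →L[ℝ] ℝ :=
  (fderiv ℝ (coordFun I h (chartAt H x)) (extChartAt I x x) : E →L[ℝ] ℝ)

/-- The gradient: `g (grad h, w) = dh (w)`. -/
def grad (g : BilinField I M) (h : M → ℝ) (x : M) : TangentSpace I x :=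
  LocalRiem.sharp (E := E) (g x) (differential (I := I) h x)

/-- `h` is a Killing potential: a smooth real function such that `J grad h` is a Killing vector
field. -/
structure IsKillingPotential (g : BilinField I M) (h : M → ℝ) : Prop where
  smooth : ∀ e ∈ atlas H M, ContDiffOn ℝ ∞ (coordFun I h e) (e.extend I).target
  killing : IsKilling g (fun x => J x (grad g h x))

/-- `g` is flat: its Riemann curvature tensor vanishes (in all charts). -/
def IsFlat (g : BilinField I M) : Prop :=
  ∀ e ∈ atlas H M, ∀ y ∈ (e.extend I).target, ∀ u v w : E,
    LocalRiem.curvature (coordBilin g e) y v w u = 0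

/-- `|dh|²`, the squared norm of the differential of `h`. -/
def normSqDifferential (g : BilinField I M) (h : M → ℝ) (x : M) : ℝ :=
  differential (I := I) h x (grad g h x)

section

variable [FiniteDimensional ℂ E]

/-- The scalar curvature at `x`, computed in the preferred chart at `x` (it does not depend on
the chart). -/
def scalarCurvature (g : BilinField I M) (x : M) : ℝ :=
  LocalRiem.scal (coordBilin g (chartAt H x)) (extChartAt I x x)

/-- The Riemannian Laplacian `Δ h = - div grad h` at `x`, computed in the preferred chart at `x`
(it does not depend on the chart). -/
def laplacian (g : BilinField I M) (h : M → ℝ) (x : M) : ℝ :=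
  LocalRiem.laplacian (coordBilin g (chartAt H x)) (coordFun I h (chartAt H x)) (extChartAt I x x)

/-- `g` has vanishing scalar curvature. -/
def IsScalarFlat (g : BilinField I M) : Prop :=
  ∀ x : M, scalarCurvature g x = 0

/-- The `(f, ν)` scalar curvature
`f² Scal(g) - 2 (ν - 1) f Δ f - ν (ν - 1) |df|²`. -/
def weightedScalarCurvature (g : BilinField I M) (f : M → ℝ) (ν : ℝ) (x : M) : ℝ :=
  f x ^ 2 * scalarCurvature g x - 2 * (ν - 1) * f x * laplacian g f x
    - ν * (ν - 1) * normSqDifferential g f x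

/-- `g` is `(f, ν)`-extremal: `g` is a Kähler metric, `f` is a Killing potential, and the `(f, ν)`
scalar curvature of `g` is a Killing potential as well. -/
structure IsWeightedExtremal (g : BilinField I M) (f : M → ℝ) (ν : ℝ) : Prop where
  isKahler : IsKahler g
  potential : IsKillingPotential g f
  extremal : IsKillingPotential g (weightedScalarCurvature g f ν)

end

/-- The product metric on `V × B`:
`g((u₁, u₂), (v₁, v₂)) = g₁(u₁, v₁) + g₂(u₂, v₂)`. The complex structure of `V × B` is the
product one, since multiplication by `Complex.I` on the product of the tangent spaces is
componentwise. -/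
def prodMetric {E F H K : Type*} [NormedAddCommGroup E] [NormedSpace ℂ E] [NormedAddCommGroup F]
    [NormedSpace ℂ F] [TopologicalSpace H] [TopologicalSpace K] {I : ModelWithCorners ℂ E H}
    {I' : ModelWithCorners ℂ F K} {V B : Type*} [TopologicalSpace V] [ChartedSpace H V]
    [TopologicalSpace B] [ChartedSpace K B] (g₁ : BilinField I V) (g₂ : BilinField I' B) :
    BilinField (I.prod I') (V × B) :=
  fun p =>
    ((g₁ p.1 : E →L[ℝ] E →L[ℝ] ℝ).bilinearComp (ContinuousLinearMap.fst ℝ E F)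
        (ContinuousLinearMap.fst ℝ E F)
      + (g₂ p.2 : F →L[ℝ] F →L[ℝ] ℝ).bilinearComp (ContinuousLinearMap.snd ℝ E F)
        (ContinuousLinearMap.snd ℝ E F) : (E × F) →L[ℝ] (E × F) →L[ℝ] ℝ)

end Kahler

end

/-!
Everything reduces to a computation on `V`. Since `Scal` is additive on products and vanishes on
both factors, and since the Laplacian and the norm of the differential of a function pulled back
from `V` are those on `V`, the `(f, ν)` scalar curvature of `V × B` is the pull-back of
`-2 (ν - 1) f Δf - ν (ν - 1) |df|²`; and the pull-back of a Killing potential is a Killing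
potential (`IsKillingPotential.comp_fst`). So it suffices that `f Δf` and `|df|²` are Killing
potentials on the flat manifold `V` (`IsKillingPotential.laplacian_add_normSq`).

Let `X = grad f` and `A = ∇X`, a symmetric endomorphism. The complex structure is parallel
(`christoffel_J`), so that `JX` is a Killing field if and only if `A` commutes with `J`
(`isKillingPotentialOn_iff`). In the absence of curvature the tensor `G((∇_u A) v, w)` is totally
symmetric by the Ricci identity, and moving `J` from one slot to another changes its sign; hence it
vanishes, and `A` is parallel (`covDerivEnd_covDeriv_gradient`). Therefore `Δf = -tr A` is locally
constant, `grad (f Δf) = Δf X` and `grad |df|² = 2 A X`, with covariant derivatives `Δf A` and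
`2 A²`, which commute with `J` (`isKillingPotentialOn_laplacian_add`).

These computations are made in each chart. The Laplacian and `|df|²` are defined by the preferred
chart at each point, so their expressions in a fixed chart rely on invariance under changes of
coordinates (`laplacian_comp`, `fderiv_coordFun`). The scalar curvature is only needed in preferred
charts, and the preferred charts of `V × B` are products.
-/

noncomputable section

/-! ### The Levi-Civita connection in coordinates -/

namespace LocalRiem

variable {E : Type*} [NormedAddCommGroup E] [NormedSpace ℝ E]

/-- `G` gives the coefficients of a smooth Riemannian metric on the open set `U`. -/
structure IsMetricOn (G : E → E →L[ℝ] E →L[ℝ] ℝ) (U : Set E) : Prop where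
  isOpen : IsOpen U
  symm : ∀ y ∈ U, ∀ u v, G y u v = G y v u
  pos : ∀ y ∈ U, ∀ u, u ≠ 0 → 0 < G y u u
  smooth : ContDiffOn ℝ ∞ G U

/-- The covariant derivative `u ↦ ∇_u X` of a vector field `X`. -/
def covDeriv (G : E → E →L[ℝ] E →L[ℝ] ℝ) (X : E → E) (y : E) : E →L[ℝ] E :=
  fderiv ℝ X y + (christoffel G y).flip (X y)

theorem covDeriv_apply (G : E → E →L[ℝ] E →L[ℝ] ℝ) (X : E → E) (y u : E) :
    covDeriv G X y u = fderiv ℝ X y u + christoffel G y u (X y) := rfl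

/-- The gradient of a function, `G (gradient h, w) = dh (w)`. -/
def gradient (G : E → E →L[ℝ] E →L[ℝ] ℝ) (h : E → ℝ) (y : E) : E :=
  sharp (G y) (fderiv ℝ h y)

theorem isInvertible_of_pos [FiniteDimensional ℝ E] {b : E →L[ℝ] E →L[ℝ] ℝ}
    (hb : ∀ u, u ≠ 0 → 0 < b u u) : b.IsInvertible := by
  have hker : LinearMap.ker (b : E →ₗ[ℝ] E →L[ℝ] ℝ) = ⊥ := by
    refine LinearMap.ker_eq_bot'.2 fun u hu => ?_
    by_contra h
    have h1 := hb u h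
    rw [show b u = 0 from hu] at h1
    simp at h1
  have hdim : Module.finrank ℝ E = Module.finrank ℝ (E →L[ℝ] ℝ) := by
    rw [← (LinearMap.toContinuousLinearMap : (E →ₗ[ℝ] ℝ) ≃ₗ[ℝ] (E →L[ℝ] ℝ)).finrank_eq]
    exact (Subspace.dual_finrank_eq (K := ℝ) (V := E)).symm
  refine ⟨(LinearEquiv.ofInjectiveOfFinrankEq (b : E →ₗ[ℝ] E →L[ℝ] ℝ)
    (LinearMap.ker_eq_bot.1 hker) hdim).toContinuousLinearEquiv, ?_⟩
  ext u v
  rfl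

theorem apply_sharp [FiniteDimensional ℝ E] {b : E →L[ℝ] E →L[ℝ] ℝ}
    (hb : ∀ u, u ≠ 0 → 0 < b u u) (α : E →L[ℝ] ℝ) : b (sharp b α) = α := by
  obtain ⟨e, rfl⟩ := isInvertible_of_pos hb
  simp [sharp]

theorem sharp_apply [FiniteDimensional ℝ E] {b : E →L[ℝ] E →L[ℝ] ℝ}
    (hb : ∀ u, u ≠ 0 → 0 < b u u) (u : E) : sharp b (b u) = u := by
  obtain ⟨e, rfl⟩ := isInvertible_of_pos hb
  simp [sharp]

theorem sharp_eq_of_apply_eq [FiniteDimensional ℝ E] {b : E →L[ℝ] E →L[ℝ] ℝ}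
    (hb : ∀ u, u ≠ 0 → 0 < b u u) {α : E →L[ℝ] ℝ} {u : E} (h : ∀ w, b u w = α w) :
    sharp b α = u := by
  rw [← show b u = α from ContinuousLinearMap.ext h, sharp_apply hb]

theorem eq_of_form_apply_eq {b : E →L[ℝ] E →L[ℝ] ℝ} (hb : ∀ u, u ≠ 0 → 0 < b u u) {u v : E}
    (h : ∀ w, b u w = b v w) : u = v := by
  by_contra hne
  have h1 := hb (u - v) (sub_ne_zero.2 hne)
  rw [map_sub b, sub_apply, h, sub_self] at h1
  exact lt_irrefl _ h1

theorem contDiffOn_fderiv_of_isOpen {F : Type*} [NormedAddCommGroup F] [NormedSpace ℝ F]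
    {f : E → F} {U : Set E} (hU : IsOpen U) (hf : ContDiffOn ℝ ∞ f U) :
    ContDiffOn ℝ ∞ (fderiv ℝ f) U :=
  hf.fderiv_of_isOpen hU (by norm_num)

theorem differentiableAt_of_contDiffOn {F : Type*} [NormedAddCommGroup F] [NormedSpace ℝ F]
    {f : E → F} {U : Set E} (hU : IsOpen U) (hf : ContDiffOn ℝ ∞ f U) {y : E} (hy : y ∈ U) :
    DifferentiableAt ℝ f y :=
  (hf.contDiffAt (hU.mem_nhds hy)).differentiableAt (by norm_num)

theorem fderiv_fderiv_symm {F : Type*} [NormedAddCommGroup F] [NormedSpace ℝ F]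
    {f : E → F} {U : Set E} (hU : IsOpen U) (hf : ContDiffOn ℝ ∞ f U) {y : E} (hy : y ∈ U)
    (u v : E) : fderiv ℝ (fderiv ℝ f) y u v = fderiv ℝ (fderiv ℝ f) y v u :=
  (hf.contDiffAt (hU.mem_nhds hy)).isSymmSndFDerivAt
    (by simpa using WithTop.coe_le_coe.2 (le_top : (2 : ℕ∞) ≤ ⊤)) u v

/-- The derivative of the coefficient `z ↦ T_z(a, X_z)` of a field of bilinear forms. -/
theorem fderiv_form_apply {T : E → E →L[ℝ] E →L[ℝ] ℝ} {X : E → E} {y : E}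
    (hT : DifferentiableAt ℝ T y) (hX : DifferentiableAt ℝ X y) (b u : E) :
    fderiv ℝ (fun z => T z (X z) b) y u = fderiv ℝ T y u (X y) b + T y (fderiv ℝ X y u) b := by
  have h1 : HasFDerivAt (fun z => T z (X z)) _ y := hT.hasFDerivAt.clm_apply hX.hasFDerivAt
  have h2 : HasFDerivAt (fun z => T z (X z) b) _ y := h1.clm_apply (hasFDerivAt_const b y)
  rw [h2.fderiv]
  simp [add_comm]

section

variable [FiniteDimensional ℝ E] {G : E → E →L[ℝ] E →L[ℝ] ℝ} {U : Set E}

namespace IsMetricOn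

variable (hG : IsMetricOn G U)
include hG

theorem contDiffOn_sharp : ContDiffOn ℝ ∞ (fun y => sharp (G y)) U := fun y hy =>
  ((isInvertible_of_pos (hG.pos y hy)).contDiffAt_map_inverse.comp_contDiffWithinAt y
    (hG.smooth y hy))

theorem contDiffOn_gradient {h : E → ℝ} (hh : ContDiffOn ℝ ∞ h U) :
    ContDiffOn ℝ ∞ (gradient G h) U :=
  hG.contDiffOn_sharp.clm_apply (contDiffOn_fderiv_of_isOpen hG.isOpen hh)

theorem contDiffOn_christoffel : ContDiffOn ℝ ∞ (christoffel G) U := by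
  have h1 : ContDiffOn ℝ ∞ (fun y => christoffelFirst G y) U := by
    have hD := contDiffOn_fderiv_of_isOpen hG.isOpen hG.smooth
    have hf : ContDiffOn ℝ ∞ (fun y => (fderiv ℝ G y).flip) U :=
      (ContinuousLinearMap.flipₗᵢ ℝ E E (E →L[ℝ] ℝ)).contDiff.comp_contDiffOn hD
    exact ContDiffOn.const_smul (1 / 2 : ℝ) ((hD.add hf).sub (contDiffOn_const.clm_comp hf))
  have h2 : ContDiffOn ℝ ∞
      (fun y => ContinuousLinearMap.compL ℝ E (E →L[ℝ] ℝ) E (sharp (G y))) U :=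
    (ContinuousLinearMap.compL ℝ E (E →L[ℝ] ℝ) E).contDiff.comp_contDiffOn hG.contDiffOn_sharp
  exact h2.clm_comp h1

omit [FiniteDimensional ℝ E] in
theorem fderiv_symm {y : E} (hy : y ∈ U) (u v w : E) :
    fderiv ℝ G y u v w = fderiv ℝ G y u w v := by
  have hd := differentiableAt_of_contDiffOn hG.isOpen hG.smooth hy
  have h : (fun z => G z v w) =ᶠ[nhds y] fun z => G z w v := by
    filter_upwards [hG.isOpen.mem_nhds hy] with z hz using hG.symm z hz v w
  have h' := DFunLike.congr_fun (h.fderiv_eq (𝕜 := ℝ)) u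
  have key : ∀ a b : E, fderiv ℝ (fun z => G z a b) y u = fderiv ℝ G y u a b := fun a b => by
    rw [fderiv_form_apply hd (differentiableAt_const a)]
    simp
  simpa only [key] using h'

theorem apply_christoffel {y : E} (hy : y ∈ U) (u v w : E) :
    G y (christoffel G y u v) w
      = (fderiv ℝ G y u v w + fderiv ℝ G y v u w - fderiv ℝ G y w u v) / 2 := by
  rw [christoffel_apply, apply_sharp (hG.pos y hy), christoffelFirst_apply]

theorem christoffel_symm {y : E} (hy : y ∈ U) (u v : E) :
    christoffel G y u v = christoffel G y v u :=
  eq_of_form_apply_eq (hG.pos y hy) fun w => by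
    rw [hG.apply_christoffel hy, hG.apply_christoffel hy, hG.fderiv_symm hy w u v]
    ring

/-- The Levi-Civita connection is metric, `∇ G = 0`. -/
theorem fderiv_eq_christoffel {y : E} (hy : y ∈ U) (u v w : E) :
    fderiv ℝ G y u v w
      = G y (christoffel G y u v) w + G y v (christoffel G y u w) := by
  rw [hG.symm y hy v, hG.apply_christoffel hy, hG.apply_christoffel hy, hG.fderiv_symm hy w u v,
    hG.fderiv_symm hy v u w, hG.fderiv_symm hy u w v]
  ring

/-- The Lie derivative of the metric, `(L_Y G)(u, v) = G(∇_u Y, v) + G(u, ∇_v Y)`. -/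
theorem lie_eq_covDeriv {y : E} (hy : y ∈ U) (Y : E → E) (u v : E) :
    fderiv ℝ G y (Y y) u v + G y (fderiv ℝ Y y u) v + G y u (fderiv ℝ Y y v)
      = G y (covDeriv G Y y u) v + G y u (covDeriv G Y y v) := by
  rw [hG.fderiv_eq_christoffel hy, covDeriv_apply, covDeriv_apply,
    hG.christoffel_symm hy (Y y) u, hG.christoffel_symm hy (Y y) v]
  simp only [map_add, add_apply]
  ring

theorem apply_gradient {h : E → ℝ} {y : E} (hy : y ∈ U) (w : E) :
    G y (gradient G h y) w = fderiv ℝ h y w := by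
  rw [gradient, apply_sharp (hG.pos y hy)]

theorem apply_covDeriv_gradient {h : E → ℝ} (hh : ContDiffOn ℝ ∞ h U) {y : E} (hy : y ∈ U)
    (u v : E) : G y (covDeriv G (gradient G h) y u) v = hessian G h y u v := by
  have hX := differentiableAt_of_contDiffOn hG.isOpen (hG.contDiffOn_gradient hh) hy
  have hd := differentiableAt_of_contDiffOn hG.isOpen hG.smooth hy
  have hdh := differentiableAt_of_contDiffOn hG.isOpen
    (contDiffOn_fderiv_of_isOpen hG.isOpen hh) hy
  have h1 : (fun z => G z (gradient G h z) v) =ᶠ[nhds y] fun z => fderiv ℝ h z v := by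
    filter_upwards [hG.isOpen.mem_nhds hy] with z hz using hG.apply_gradient hz v
  have h2 := DFunLike.congr_fun (h1.fderiv_eq (𝕜 := ℝ)) u
  rw [fderiv_form_apply hd hX, HasFDerivAt.fderiv (f := fun z => fderiv ℝ h z v)
    (hdh.hasFDerivAt.clm_apply (hasFDerivAt_const v y))] at h2
  simp only [add_apply, ContinuousLinearMap.comp_apply, zero_apply, map_zero,
    ContinuousLinearMap.flip_apply, zero_add] at h2
  rw [hG.fderiv_eq_christoffel hy, hG.apply_gradient hy] at h2
  rw [hessian_apply, covDeriv_apply, map_add, add_apply, ← h2]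
  ring

theorem hessian_symm {h : E → ℝ} (hh : ContDiffOn ℝ ∞ h U) {y : E} (hy : y ∈ U)
    (u v : E) : hessian G h y u v = hessian G h y v u := by
  rw [hessian_apply, hessian_apply, hG.christoffel_symm hy, fderiv_fderiv_symm hG.isOpen hh hy]

/-- `2 ∇ dh = L_{grad h} G`. -/
theorem two_mul_hessian {h : E → ℝ} (hh : ContDiffOn ℝ ∞ h U) {y : E} (hy : y ∈ U)
    (u v : E) : 2 * hessian G h y u v
      = fderiv ℝ G y (gradient G h y) u v + G y (fderiv ℝ (gradient G h) y u) v
        + G y u (fderiv ℝ (gradient G h) y v) := by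
  rw [hG.lie_eq_covDeriv hy, hG.symm y hy u, hG.apply_covDeriv_gradient hh hy,
    hG.apply_covDeriv_gradient hh hy, hG.hessian_symm hh hy v u]
  ring

theorem laplacian_eq_neg_trace {h : E → ℝ} (hh : ContDiffOn ℝ ∞ h U) {y : E} (hy : y ∈ U) :
    laplacian G h y = - LinearMap.trace ℝ E (covDeriv G (gradient G h) y).toLinearMap := by
  rw [laplacian, metricTrace]
  congr 2
  ext u
  refine sharp_eq_of_apply_eq (hG.pos y hy) fun w => ?_
  exact hG.apply_covDeriv_gradient hh hy u w

/-- The Ricci identity for `∇² X`, `∇²_{u,v} X - ∇²_{v,u} X = R(u, v) X`, where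
`(∇_u A) v = ∂_u A v + Γ(u, A v) - A Γ(u, v)` for `A = ∇ X`. -/
theorem ricci_identity {X : E → E} (hX : ContDiffOn ℝ ∞ X U) {y : E} (hy : y ∈ U) (u v : E) :
    (fderiv ℝ (covDeriv G X) y u v + christoffel G y u (covDeriv G X y v)
        - covDeriv G X y (christoffel G y u v))
      - (fderiv ℝ (covDeriv G X) y v u + christoffel G y v (covDeriv G X y u)
        - covDeriv G X y (christoffel G y v u))
      = curvature G y v (X y) u := by
  have hXd := differentiableAt_of_contDiffOn hG.isOpen hX hy
  have hDX := differentiableAt_of_contDiffOn hG.isOpen (contDiffOn_fderiv_of_isOpen hG.isOpen hX) hy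
  have hΓ := differentiableAt_of_contDiffOn hG.isOpen hG.contDiffOn_christoffel hy
  have key : ∀ a b, fderiv ℝ (covDeriv G X) y a b = fderiv ℝ (fderiv ℝ X) y a b
      + fderiv ℝ (christoffel G) y a b (X y) + christoffel G y b (fderiv ℝ X y a) := by
    intro a b
    have h1 : HasFDerivAt (fun z => (christoffel G z).flip)
        ((ContinuousLinearMap.flipₗᵢ ℝ E E E).toContinuousLinearEquiv.toContinuousLinearMap.comp
          (fderiv ℝ (christoffel G) y)) y :=
      (ContinuousLinearMap.flipₗᵢ ℝ E E E).toContinuousLinearEquiv.hasFDerivAt.comp y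
        hΓ.hasFDerivAt
    have h2 : HasFDerivAt (covDeriv G X) _ y :=
      hDX.hasFDerivAt.add (h1.clm_apply hXd.hasFDerivAt)
    rw [h2.fderiv]
    simp
    abel
  rw [key, key, fderiv_fderiv_symm hG.isOpen hX hy v u, hG.christoffel_symm hy v u]
  simp only [covDeriv_apply, curvature, LinearMap.coe_mk, AddHom.coe_mk, map_add]
  abel

end IsMetricOn

end

end LocalRiem

/-! ### Killing potentials of flat Kähler metrics in coordinates -/

namespace LocalRiem

/-- A totally symmetric tensor `T` on which moving `J` from one slot to another changes the sign
vanishes: three such moves, around the three slots, bring `J` back to where it started. -/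
theorem eq_zero_of_symm_of_skew {E : Type*} [AddCommGroup E] {J : E → E}
    (hJ : ∀ u, J (J u) = -u) {T : E → E → E → ℝ}
    (h12 : ∀ u v w, T u v w = T v u w) (h23 : ∀ u v w, T u v w = T u w v)
    (hskew : ∀ u v w, T u (J v) w = -T u v (J w)) (hneg : ∀ u v w, T (-u) v w = -T u v w)
    (u v w : E) : T u v w = 0 := by
  have h0 : ∀ a b c, T (J a) b c = 0 := fun a b c => by
    have h1 : T (J a) b c = -T a b (J c) := by rw [h12, hskew, h12]
    have h2 : T (J a) b c = -T a (J b) c := by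
      rw [h12, h23, h12, ← neg_neg (T c b (J a)), ← hskew, h12 c, h23, h12]
    linarith [hskew a b c]
  have := h0 (J u) v w
  rw [hJ, hneg] at this
  linarith

variable {E : Type*} [NormedAddCommGroup E] [NormedSpace ℝ E]

/-- `G` gives the coefficients of a Kähler metric on the open set `U`, for the constant complex
structure `J`; the coefficients of the fundamental form are `G (J v, w)`. -/
structure IsKahlerOn (J : E →L[ℝ] E) (G : E → E →L[ℝ] E →L[ℝ] ℝ) (U : Set E) : Prop
    extends IsMetricOn G U where
  J_sq : ∀ u, J (J u) = -u
  hermitian : ∀ y ∈ U, ∀ u v, G y (J u) (J v) = G y u v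
  closed : ∀ y ∈ U, ∀ u v w, fderiv ℝ G y u (J v) w + fderiv ℝ G y v (J w) u
    + fderiv ℝ G y w (J u) v = 0

/-- `h` is a Killing potential on `U`: the Lie derivative `L_{J grad h} G` vanishes there.
Smoothness is not part of the definition. -/
def IsKillingPotentialOn (J : E →L[ℝ] E) (G : E → E →L[ℝ] E →L[ℝ] ℝ) (h : E → ℝ) (U : Set E) :
    Prop :=
  ∀ y ∈ U, ∀ u v, fderiv ℝ G y (J (gradient G h y)) u v
    + G y (fderiv ℝ (fun z => J (gradient G h z)) y u) v
    + G y u (fderiv ℝ (fun z => J (gradient G h z)) y v) = 0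

/-- The covariant derivative of an endomorphism field,
`(∇_u A) v = ∂_u A v + Γ(u, A v) - A Γ(u, v)`. -/
def covDerivEnd (G : E → E →L[ℝ] E →L[ℝ] ℝ) (A : E → E →L[ℝ] E) (y u v : E) : E :=
  fderiv ℝ A y u v + christoffel G y u (A y v) - A y (christoffel G y u v)

variable [FiniteDimensional ℝ E] {J : E →L[ℝ] E} {G : E → E →L[ℝ] E →L[ℝ] ℝ} {U : Set E}

theorem contDiffOn_covDeriv (hG : IsMetricOn G U) {X : E → E} (hX : ContDiffOn ℝ ∞ X U) :
    ContDiffOn ℝ ∞ (covDeriv G X) U := by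
  have h1 : ContDiffOn ℝ ∞ (fun z => (christoffel G z).flip) U :=
    (ContinuousLinearMap.flipₗᵢ ℝ E E E).contDiff.comp_contDiffOn hG.contDiffOn_christoffel
  exact (contDiffOn_fderiv_of_isOpen hG.isOpen hX).add (h1.clm_apply hX)

/-- The covariant derivatives of a symmetric endomorphism field are symmetric. -/
theorem covDerivEnd_symm (hG : IsMetricOn G U) {A : E → E →L[ℝ] E} (hA : ContDiffOn ℝ ∞ A U)
    (hs : ∀ y ∈ U, ∀ u v, G y (A y u) v = G y u (A y v)) {y : E} (hy : y ∈ U) (u v w : E) :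
    G y (covDerivEnd G A y u v) w = G y (covDerivEnd G A y u w) v := by
  have hd := differentiableAt_of_contDiffOn hG.isOpen hG.smooth hy
  have hAd := differentiableAt_of_contDiffOn hG.isOpen hA hy
  have h1 : (fun z => G z (A z v) w) =ᶠ[nhds y] fun z => G z (A z w) v := by
    filter_upwards [hG.isOpen.mem_nhds hy] with z hz
    rw [hs z hz, hG.symm z hz]
  have hAv : ∀ a b, fderiv ℝ (fun z => A z a) y b = fderiv ℝ A y b a := fun a b => by
    rw [HasFDerivAt.fderiv (f := fun z => A z a)
      (hAd.hasFDerivAt.clm_apply (hasFDerivAt_const a y))]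
    simp
  have hAd' : ∀ a, DifferentiableAt ℝ (fun z => A z a) y := fun a =>
    hAd.clm_apply (differentiableAt_const a)
  have h2 := DFunLike.congr_fun (h1.fderiv_eq (𝕜 := ℝ)) u
  rw [fderiv_form_apply hd (hAd' v), fderiv_form_apply hd (hAd' w), hAv, hAv,
    hG.fderiv_eq_christoffel hy, hG.fderiv_eq_christoffel hy] at h2
  simp only [covDerivEnd, map_add, map_sub, add_apply, sub_apply]
  have h3 := hs y hy v (christoffel G y u w)
  have h4 := hs y hy w (christoffel G y u v)
  have h5 := hG.symm y hy v (A y (christoffel G y u w))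
  have h6 := hG.symm y hy w (A y (christoffel G y u v))
  linarith

namespace IsKahlerOn

variable (hG : IsKahlerOn J G U)
include hG

omit [FiniteDimensional ℝ E] in
theorem apply_J_left {y : E} (hy : y ∈ U) (u v : E) : G y (J u) v = -G y u (J v) := by
  have := hG.hermitian y hy u (J v)
  rw [hG.J_sq, map_neg] at this
  linarith

omit [FiniteDimensional ℝ E] in
theorem fderiv_apply_J_left {y : E} (hy : y ∈ U) (u v w : E) :
    fderiv ℝ G y u (J v) w = -fderiv ℝ G y u v (J w) := by
  have hd := differentiableAt_of_contDiffOn hG.isOpen hG.smooth hy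
  have h : (fun z => G z (J v) w) =ᶠ[nhds y] fun z => -G z v (J w) := by
    filter_upwards [hG.isOpen.mem_nhds hy] with z hz using hG.apply_J_left hz v w
  have h' := DFunLike.congr_fun (h.fderiv_eq (𝕜 := ℝ)) u
  rw [fderiv_fun_neg, neg_apply, fderiv_form_apply hd (differentiableAt_const _),
    fderiv_form_apply hd (differentiableAt_const _)] at h'
  simpa using h'

/-- The complex structure of a Kähler metric is parallel. -/
theorem christoffel_J {y : E} (hy : y ∈ U) (u v : E) :
    christoffel G y u (J v) = J (christoffel G y u v) := by
  refine eq_of_form_apply_eq (hG.pos y hy) fun w => ?_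
  rw [hG.apply_J_left hy, hG.apply_christoffel hy, hG.apply_christoffel hy]
  -- The identity is the sum of `dω(u, v, w) = 0` and `dω(u, J v, J w) = 0`.
  have h1 := hG.closed y hy u v w
  have h2 := hG.closed y hy u (J v) (J w)
  simp only [hG.J_sq, map_neg, neg_apply] at h2
  have h3 := hG.fderiv_apply_J_left hy u v w
  have h4 := hG.fderiv_apply_J_left hy w u v
  have h5 := hG.fderiv_apply_J_left hy (J w) u (J v)
  simp only [hG.J_sq, map_neg] at h5
  have h6 := hG.fderiv_symm hy v (J w) u
  have h7 := hG.fderiv_symm hy (J v) w u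
  linarith

theorem covDeriv_J {X : E → E} {y : E} (hX : DifferentiableAt ℝ X y) (hy : y ∈ U) (u : E) :
    covDeriv G (fun z => J (X z)) y u = J (covDeriv G X y u) := by
  rw [covDeriv_apply, covDeriv_apply, hG.christoffel_J hy, map_add,
    HasFDerivAt.fderiv (f := fun z => J (X z)) (J.hasFDerivAt.comp y hX.hasFDerivAt)]
  rfl

/-- A function is a Killing potential if and only if its Hessian endomorphism commutes
with `J`. -/
theorem isKillingPotentialOn_iff {h : E → ℝ} (hh : ContDiffOn ℝ ∞ h U) :
    IsKillingPotentialOn J G h U ↔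
      ∀ y ∈ U, ∀ u, covDeriv G (gradient G h) y (J u) = J (covDeriv G (gradient G h) y u) := by
  refine forall₂_congr fun y hy => ?_
  have hX := differentiableAt_of_contDiffOn hG.isOpen (hG.contDiffOn_gradient hh) hy
  have key : ∀ u v, fderiv ℝ G y (J (gradient G h y)) u v
      + G y (fderiv ℝ (fun z => J (gradient G h z)) y u) v
      + G y u (fderiv ℝ (fun z => J (gradient G h z)) y v)
      = G y (J (covDeriv G (gradient G h) y u) - covDeriv G (gradient G h) y (J u)) v := by
    intro u v
    rw [hG.lie_eq_covDeriv hy (fun z => J (gradient G h z)), hG.covDeriv_J hX hy,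
      hG.covDeriv_J hX hy, map_sub, sub_apply, hG.apply_covDeriv_gradient hh hy (J u),
      hG.hessian_symm hh hy, ← hG.apply_covDeriv_gradient hh hy, hG.symm y hy _ (J u),
      hG.apply_J_left hy u]
    ring
  simp only [key]
  refine ⟨fun H u => (eq_of_form_apply_eq (hG.pos y hy) fun v => ?_).symm, fun H u v => ?_⟩
  · have := H u v
    rw [map_sub, sub_apply] at this
    linarith
  · rw [H, sub_self, map_zero, zero_apply]

variable {h : E → ℝ} (hflat : ∀ y ∈ U, ∀ u v w, curvature G y v w u = 0)
  (hh : ContDiffOn ℝ ∞ h U) (hK : IsKillingPotentialOn J G h U)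
include hflat hh hK

/-- On a flat Kähler manifold the Hessian of a Killing potential is parallel. -/
theorem covDerivEnd_covDeriv_gradient {y : E} (hy : y ∈ U) (u v : E) :
    covDerivEnd G (covDeriv G (gradient G h)) y u v = 0 := by
  set A := covDeriv G (gradient G h) with hAdef
  have hX := hG.contDiffOn_gradient hh
  have hA : ContDiffOn ℝ ∞ A U := contDiffOn_covDeriv hG.toIsMetricOn hX
  have hAd := differentiableAt_of_contDiffOn hG.isOpen hA hy
  have hAJ := (hG.isKillingPotentialOn_iff hh).1 hK
  have hs : ∀ z ∈ U, ∀ u v, G z (A z u) v = G z u (A z v) := fun z hz a b => by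
    rw [hG.symm z hz a, hG.apply_covDeriv_gradient hh hz, hG.apply_covDeriv_gradient hh hz,
      hG.hessian_symm hh hz]
  -- `∇ A` commutes with `J`.
  have hcomm : ∀ a b, covDerivEnd G A y a (J b) = J (covDerivEnd G A y a b) := fun a b => by
    have hD : fderiv ℝ A y a (J b) = J (fderiv ℝ A y a b) := by
      have e : (fun z => A z (J b)) =ᶠ[nhds y] fun z => J (A z b) := by
        filter_upwards [hG.isOpen.mem_nhds hy] with z hz using hAJ z hz b
      have e' := DFunLike.congr_fun (e.fderiv_eq (𝕜 := ℝ)) a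
      rw [HasFDerivAt.fderiv (f := fun z => A z (J b))
          (hAd.hasFDerivAt.clm_apply (hasFDerivAt_const (J b) y)),
        HasFDerivAt.fderiv (f := fun z => J (A z b))
          (J.hasFDerivAt.comp y (hAd.hasFDerivAt.clm_apply (hasFDerivAt_const b y)))] at e'
      simpa using e'
    have hAy : ∀ c, A y (J c) = J (A y c) := hAJ y hy
    simp only [covDerivEnd, hD, hG.christoffel_J hy, hAy, map_add, map_sub]
  have hR : ∀ a b, covDerivEnd G A y a b = covDerivEnd G A y b a := fun a b => by
    have := hG.ricci_identity hX hy a b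
    rw [hflat y hy] at this
    exact sub_eq_zero.1 this
  have hneg : ∀ a b, covDerivEnd G A y (-a) b = -covDerivEnd G A y a b := fun a b => by
    simp only [covDerivEnd, map_neg, neg_apply]
    abel
  have hT := eq_zero_of_symm_of_skew hG.J_sq
    (T := fun a b c => G y (covDerivEnd G A y a b) c) (fun a b c => by simp only [hR a b])
    (fun a b c => covDerivEnd_symm hG.toIsMetricOn hA hs hy a b c)
    (fun a b c => by simp only [hcomm, hG.apply_J_left hy])
    (fun a b c => by simp only [hneg, map_neg, neg_apply])
  exact eq_of_form_apply_eq (hG.pos y hy) fun w => by simpa using hT u v w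

/-- On a flat Kähler manifold the Laplacian of a Killing potential is locally constant. -/
theorem hasFDerivAt_laplacian {y : E} (hy : y ∈ U) :
    HasFDerivAt (laplacian G h) (0 : E →L[ℝ] ℝ) y := by
  set A := covDeriv G (gradient G h) with hAdef
  have hA : ContDiffOn ℝ ∞ A U :=
    contDiffOn_covDeriv hG.toIsMetricOn (hG.contDiffOn_gradient hh)
  have hAd := differentiableAt_of_contDiffOn hG.isOpen hA hy
  let tr : (E →L[ℝ] E) →L[ℝ] ℝ :=
    LinearMap.toContinuousLinearMap (LinearMap.trace ℝ E ∘ₗ ContinuousLinearMap.coeLM ℝ)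
  have htr : HasFDerivAt (fun z => -tr (A z)) (-(tr.comp (fderiv ℝ A y))) y :=
    (tr.hasFDerivAt.comp y hAd.hasFDerivAt).neg
  have h0 : -(tr.comp (fderiv ℝ A y)) = 0 := by
    ext u
    -- As `∇ A = 0`, the derivative of `A` is a commutator, whose trace vanishes.
    have hc : fderiv ℝ A y u = A y * christoffel G y u - christoffel G y u * A y := by
      ext v
      have := hG.covDerivEnd_covDeriv_gradient hflat hh hK hy u v
      rw [covDerivEnd, sub_eq_zero] at this
      exact eq_sub_of_add_eq this
    have ht : ∀ P Q : E →L[ℝ] E, tr (P * Q) = tr (Q * P) := fun P Q =>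
      LinearMap.trace_mul_comm ℝ (P : E →ₗ[ℝ] E) (Q : E →ₗ[ℝ] E)
    simp [hc, ht (A y)]
  rw [h0] at htr
  refine htr.congr_of_eventuallyEq ?_
  filter_upwards [hG.isOpen.mem_nhds hy] with z hz using hG.laplacian_eq_neg_trace hh hz

omit hflat hK in
theorem contDiffOn_laplacian : ContDiffOn ℝ ∞ (laplacian G h) U := by
  have hA : ContDiffOn ℝ ∞ (covDeriv G (gradient G h)) U :=
    contDiffOn_covDeriv hG.toIsMetricOn (hG.contDiffOn_gradient hh)
  let tr : (E →L[ℝ] E) →L[ℝ] ℝ :=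
    LinearMap.toContinuousLinearMap (LinearMap.trace ℝ E ∘ₗ ContinuousLinearMap.coeLM ℝ)
  exact (tr.contDiff.comp_contDiffOn hA).neg.congr fun z hz => hG.laplacian_eq_neg_trace hh hz

omit hflat hK in
theorem contDiffOn_fderiv_gradient :
    ContDiffOn ℝ ∞ (fun y => fderiv ℝ h y (gradient G h y)) U :=
  (contDiffOn_fderiv_of_isOpen hG.isOpen hh).clm_apply (hG.contDiffOn_gradient hh)

omit hflat hK in
/-- `d |dh|² = 2 ∇dh (·, grad h)`. -/
theorem fderiv_fderiv_gradient {y : E} (hy : y ∈ U) (u : E) :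
    fderiv ℝ (fun z => fderiv ℝ h z (gradient G h z)) y u
      = 2 * G y (covDeriv G (gradient G h) y (gradient G h y)) u := by
  have hX := differentiableAt_of_contDiffOn hG.isOpen (hG.contDiffOn_gradient hh) hy
  have hdh := differentiableAt_of_contDiffOn hG.isOpen
    (contDiffOn_fderiv_of_isOpen hG.isOpen hh) hy
  rw [HasFDerivAt.fderiv (f := fun z => fderiv ℝ h z (gradient G h z))
      (hdh.hasFDerivAt.clm_apply hX.hasFDerivAt), hG.apply_covDeriv_gradient hh hy,
    hG.hessian_symm hh hy]
  have h1 := hG.apply_covDeriv_gradient hh hy u (gradient G h y)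
  rw [hG.symm y hy, hG.apply_gradient hy, covDeriv_apply, map_add] at h1
  have h2 := hessian_apply G h y u (gradient G h y)
  simp only [add_apply, ContinuousLinearMap.comp_apply, ContinuousLinearMap.flip_apply]
  linarith

/-- On a flat Kähler manifold, `h Δ h` and `|dh|²` are Killing potentials for every Killing
potential `h`. The gradient of `a h Δ h + b |dh|²` is `a Δh grad h + 2 b A grad h` with the parallel
endomorphism `A = ∇ grad h`; its covariant derivative `a Δh A + 2 b A²` commutes with `J`. -/
theorem isKillingPotentialOn_laplacian_add (a b : ℝ) :
    IsKillingPotentialOn J G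
      (fun y => a * (h y * laplacian G h y) + b * fderiv ℝ h y (gradient G h y)) U := by
  set A := covDeriv G (gradient G h) with hAdef
  have hX := hG.contDiffOn_gradient hh
  have hA : ContDiffOn ℝ ∞ A U := contDiffOn_covDeriv hG.toIsMetricOn hX
  have hΔ := hG.contDiffOn_laplacian hh
  have hN := hG.contDiffOn_fderiv_gradient hh
  have hAJ := (hG.isKillingPotentialOn_iff hh).1 hK
  refine (hG.isKillingPotentialOn_iff
    ((contDiffOn_const.mul (hh.mul hΔ)).add (contDiffOn_const.mul hN))).2 fun y hy => ?_
  have hgrad : ∀ z ∈ U, gradient G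
      (fun y => a * (h y * laplacian G h y) + b * fderiv ℝ h y (gradient G h y)) z
      = (a * laplacian G h z) • gradient G h z + (2 * b) • A z (gradient G h z) := by
    intro z hz
    refine sharp_eq_of_apply_eq (hG.pos z hz) fun w => ?_
    have hhd := (differentiableAt_of_contDiffOn hG.isOpen hh hz).hasFDerivAt
    have hNd := (differentiableAt_of_contDiffOn hG.isOpen hN hz).hasFDerivAt
    rw [HasFDerivAt.fderiv (f := fun y => a * (h y * laplacian G h y)
      + b * fderiv ℝ h y (gradient G h y)) (((hhd.mul
        (hG.hasFDerivAt_laplacian hflat hh hK hz)).const_mul a).add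
      (hNd.const_mul b))]
    simp only [add_apply, smul_apply, map_add, map_smul, smul_eq_mul, hG.apply_gradient hz,
      hG.fderiv_fderiv_gradient hh hz, zero_apply, ← hAdef]
    ring
  have hcov : ∀ u, covDeriv G (gradient G
      (fun y => a * (h y * laplacian G h y) + b * fderiv ℝ h y (gradient G h y))) y u
      = (a * laplacian G h y) • A y u + (2 * b) • A y (A y u) := by
    intro u
    have hXd := (differentiableAt_of_contDiffOn hG.isOpen hX hy).hasFDerivAt
    have hAd := (differentiableAt_of_contDiffOn hG.isOpen hA hy).hasFDerivAt
    have e := Filter.eventuallyEq_of_mem (hG.isOpen.mem_nhds hy) hgrad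
    have hp := hG.covDerivEnd_covDeriv_gradient hflat hh hK hy u (gradient G h y)
    rw [covDerivEnd, sub_eq_zero, ← hAdef] at hp
    rw [covDeriv_apply, e.fderiv_eq, hgrad y hy, HasFDerivAt.fderiv
      (f := fun z => (a * laplacian G h z) • gradient G h z + (2 * b) • A z (gradient G h z))
      ((((hG.hasFDerivAt_laplacian hflat hh hK hy).const_mul a).smul hXd).add
        ((hAd.clm_apply hXd).const_smul (2 * b)))]
    have hAu : A y u = fderiv ℝ (gradient G h) y u + christoffel G y u (gradient G h y) := rfl
    rw [hAu, map_add (A y), ← hp]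
    simp only [add_apply, smul_apply, map_add, map_smul, zero_apply, smul_zero,
      ContinuousLinearMap.comp_apply, ContinuousLinearMap.flip_apply,
      ContinuousLinearMap.smulRight_apply, zero_smul, add_zero, smul_add]
    abel
  intro u
  rw [hcov, hcov, hAJ y hy, hAJ y hy, map_add, map_smul, map_smul]

end IsKahlerOn

end LocalRiem

/-! ### Invariance of the Laplacian under changes of coordinates -/

namespace LocalRiem

section Invariance

variable {E : Type*} [NormedAddCommGroup E] [NormedSpace ℝ E] [FiniteDimensional ℝ E]

/-- An isometry `φ` between metrics on open sets preserves Laplacians. The Hessian is preserved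
because it is half the Lie derivative of the metric along the gradient, in which the second
derivatives of `φ` cancel. -/
theorem laplacian_comp {G G' : E → E →L[ℝ] E →L[ℝ] ℝ} {U U' : Set E} (hG : IsMetricOn G U)
    (hG' : IsMetricOn G' U') {h h' : E → ℝ} (hh : ContDiffOn ℝ ∞ h U) (hh' : ContDiffOn ℝ ∞ h' U')
    {φ : E → E} {W : Set E} (hW : IsOpen W) (hWU : W ⊆ U) (hφU : Set.MapsTo φ W U')
    (hφ : ContDiffOn ℝ ∞ φ W)
    (hGG' : ∀ z ∈ W, ∀ u v, G z u v = G' (φ z) (fderiv ℝ φ z u) (fderiv ℝ φ z v))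
    (hhh' : ∀ z ∈ W, h z = h' (φ z)) {y : E} (hy : y ∈ W) :
    laplacian G h y = laplacian G' h' (φ y) := by
  -- The differential of an isometry is injective, hence bijective, since `G` is definite.
  have hinj : ∀ z ∈ W, Function.Injective (fderiv ℝ φ z) := fun z hz =>
    (injective_iff_map_eq_zero _).2 fun u hu => by
      by_contra hne
      have := hG.pos z (hWU hz) u hne
      rw [hGG' z hz, hu] at this
      simp at this
  have hsurj : ∀ z ∈ W, Function.Surjective (fderiv ℝ φ z) := fun z hz =>
    (LinearMap.injective_iff_surjective (f := (fderiv ℝ φ z : E →ₗ[ℝ] E))).1 (hinj z hz)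
  have hφd : ∀ z ∈ W, DifferentiableAt ℝ φ z := fun z hz => differentiableAt_of_contDiffOn hW hφ hz
  have hgrad : ∀ z ∈ W, fderiv ℝ φ z (gradient G h z) = gradient G' h' (φ z) := fun z hz => by
    refine eq_of_form_apply_eq (hG'.pos _ (hφU hz)) fun w => ?_
    obtain ⟨w, rfl⟩ := hsurj z hz w
    have e : h =ᶠ[nhds z] h' ∘ φ := Filter.eventuallyEq_of_mem (hW.mem_nhds hz) hhh'
    rw [← hGG' z hz, hG.apply_gradient (hWU hz), hG'.apply_gradient (hφU hz), e.fderiv_eq,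
      fderiv_comp z (differentiableAt_of_contDiffOn hG'.isOpen hh' (hφU hz)) (hφd z hz)]
    rfl
  have hyU := hWU hy
  have hyU' := hφU hy
  have hX := differentiableAt_of_contDiffOn hG.isOpen (hG.contDiffOn_gradient hh) hyU
  have hX' := differentiableAt_of_contDiffOn hG'.isOpen (hG'.contDiffOn_gradient hh') hyU'
  have hDφ := differentiableAt_of_contDiffOn hW (contDiffOn_fderiv_of_isOpen hW hφ) hy
  have hGd := differentiableAt_of_contDiffOn hG.isOpen hG.smooth hyU
  have hGd' := differentiableAt_of_contDiffOn hG'.isOpen hG'.smooth hyU'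
  -- The derivatives of `dφ X = X' ∘ φ` and of `G = φ^* G'`.
  have hDX : ∀ u, fderiv ℝ (fderiv ℝ φ) y u (gradient G h y)
      + fderiv ℝ φ y (fderiv ℝ (gradient G h) y u)
      = fderiv ℝ (gradient G' h') (φ y) (fderiv ℝ φ y u) := fun u => by
    have e : (fun z => fderiv ℝ φ z (gradient G h z)) =ᶠ[nhds y] gradient G' h' ∘ φ :=
      Filter.eventuallyEq_of_mem (hW.mem_nhds hy) hgrad
    have := DFunLike.congr_fun (e.fderiv_eq (𝕜 := ℝ)) u
    rw [HasFDerivAt.fderiv (f := fun z => fderiv ℝ φ z (gradient G h z))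
      (hDφ.hasFDerivAt.clm_apply hX.hasFDerivAt), fderiv_comp y hX' (hφd y hy)] at this
    simpa [add_comm] using this
  have hDG : ∀ a u v, fderiv ℝ G y a u v
      = fderiv ℝ G' (φ y) (fderiv ℝ φ y a) (fderiv ℝ φ y u) (fderiv ℝ φ y v)
        + G' (φ y) (fderiv ℝ (fderiv ℝ φ) y a u) (fderiv ℝ φ y v)
        + G' (φ y) (fderiv ℝ φ y u) (fderiv ℝ (fderiv ℝ φ) y a v) := fun a u v => by
    have e : (fun z => G z u v) =ᶠ[nhds y]
        fun z => G' (φ z) (fderiv ℝ φ z u) (fderiv ℝ φ z v) :=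
      Filter.eventuallyEq_of_mem (hW.mem_nhds hy) fun z hz => hGG' z hz u v
    have := DFunLike.congr_fun (e.fderiv_eq (𝕜 := ℝ)) a
    have h1 : HasFDerivAt (fun z => G' (φ z)) _ y :=
      hGd'.hasFDerivAt.comp y (hφd y hy).hasFDerivAt
    have h2 : ∀ w, HasFDerivAt (fun z => fderiv ℝ φ z w) _ y := fun w =>
      hDφ.hasFDerivAt.clm_apply (hasFDerivAt_const w y)
    have h3 : HasFDerivAt (fun z => G' (φ z) (fderiv ℝ φ z u)) _ y := h1.clm_apply (h2 u)
    rw [fderiv_form_apply hGd (differentiableAt_const u),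
      HasFDerivAt.fderiv (f := fun z => G' (φ z) (fderiv ℝ φ z u) (fderiv ℝ φ z v))
        (h3.clm_apply (h2 v))] at this
    simp at this
    rw [this]
    ring
  have hHess : ∀ u v, hessian G h y u v
      = hessian G' h' (φ y) (fderiv ℝ φ y u) (fderiv ℝ φ y v) := fun u v => by
    have h1 := hG.two_mul_hessian hh hyU u v
    have h2 := hG'.two_mul_hessian hh' hyU' (fderiv ℝ φ y u) (fderiv ℝ φ y v)
    rw [hDG, hGG' y hy, hGG' y hy, fderiv_fderiv_symm hW hφ hy _ u,
      fderiv_fderiv_symm hW hφ hy _ v, hgrad y hy] at h1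
    rw [← hDX, ← hDX] at h2
    simp only [map_add, add_apply] at h2
    linarith
  let L : E ≃ₗ[ℝ] E :=
    LinearEquiv.ofBijective (fderiv ℝ φ y : E →ₗ[ℝ] E) ⟨hinj y hy, hsurj y hy⟩
  have hL : ∀ u, L u = fderiv ℝ φ y u := fun u => rfl
  rw [hG.laplacian_eq_neg_trace hh hyU, hG'.laplacian_eq_neg_trace hh' hyU',
    ← LinearMap.trace_conj' (covDeriv G (gradient G h) y).toLinearMap L]
  congr 2
  ext u
  rw [LinearEquiv.conj_apply_apply]
  refine eq_of_form_apply_eq (hG'.pos _ hyU') fun w => ?_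
  obtain ⟨w, rfl⟩ := L.surjective w
  obtain ⟨u, rfl⟩ := L.surjective u
  rw [L.symm_apply_apply, hL, hL, ← hGG' y hy]
  exact (hG.apply_covDeriv_gradient hh hyU _ _).trans
    ((hHess u w).trans (hG'.apply_covDeriv_gradient hh' hyU' _ _).symm)

end Invariance

/-! ### Product metrics in coordinates -/

section Product

variable {E : Type*} [NormedAddCommGroup E] [NormedSpace ℝ E]
  {F : Type*} [NormedAddCommGroup F] [NormedSpace ℝ F]

/-- The orthogonal sum of two bilinear forms. -/
def prodForm (b : E →L[ℝ] E →L[ℝ] ℝ) (c : F →L[ℝ] F →L[ℝ] ℝ) : (E × F) →L[ℝ] (E × F) →L[ℝ] ℝ :=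
  b.bilinearComp (ContinuousLinearMap.fst ℝ E F) (ContinuousLinearMap.fst ℝ E F)
    + c.bilinearComp (ContinuousLinearMap.snd ℝ E F) (ContinuousLinearMap.snd ℝ E F)

@[simp]
theorem prodForm_apply (b : E →L[ℝ] E →L[ℝ] ℝ) (c : F →L[ℝ] F →L[ℝ] ℝ) (u v : E × F) :
    prodForm b c u v = b u.1 v.1 + c u.2 v.2 := rfl

/-- The coefficients of a product metric. -/
def prodCoeff (G : E → E →L[ℝ] E →L[ℝ] ℝ) (G' : F → F →L[ℝ] F →L[ℝ] ℝ) (y : E × F) :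
    (E × F) →L[ℝ] (E × F) →L[ℝ] ℝ :=
  prodForm (G y.1) (G' y.2)

@[simp]
theorem prodCoeff_apply (G : E → E →L[ℝ] E →L[ℝ] ℝ) (G' : F → F →L[ℝ] F →L[ℝ] ℝ)
    (y u v : E × F) :
    prodCoeff G G' y u v = G y.1 u.1 v.1 + G' y.2 u.2 v.2 := rfl

theorem prodForm_pos {b : E →L[ℝ] E →L[ℝ] ℝ} {c : F →L[ℝ] F →L[ℝ] ℝ}
    (hb : ∀ u, u ≠ 0 → 0 < b u u) (hc : ∀ u, u ≠ 0 → 0 < c u u) (u : E × F) (hu : u ≠ 0) :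
    0 < prodForm b c u u := by
  rw [prodForm_apply]
  have h1 : 0 ≤ b u.1 u.1 := by
    rcases eq_or_ne u.1 0 with h | h
    · simp [h]
    · exact (hb _ h).le
  have h2 : 0 ≤ c u.2 u.2 := by
    rcases eq_or_ne u.2 0 with h | h
    · simp [h]
    · exact (hc _ h).le
  rcases eq_or_ne u.1 0 with h | h
  · have : u.2 ≠ 0 := fun h' => hu (Prod.ext h h')
    linarith [hc _ this]
  · linarith [hb _ h]

theorem fderiv_comp_fst {K : Type*} [NormedAddCommGroup K] [NormedSpace ℝ K] {X : E → K}
    {y : E × F} (hX : DifferentiableAt ℝ X y.1) (u : E × F) :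
    fderiv ℝ (fun z : E × F => X z.1) y u = fderiv ℝ X y.1 u.1 := by
  rw [HasFDerivAt.fderiv (f := fun z : E × F => X z.1) (hX.hasFDerivAt.comp y hasFDerivAt_fst)]
  rfl

theorem fderiv_comp_snd {K : Type*} [NormedAddCommGroup K] [NormedSpace ℝ K] {X : F → K}
    {y : E × F} (hX : DifferentiableAt ℝ X y.2) (u : E × F) :
    fderiv ℝ (fun z : E × F => X z.2) y u = fderiv ℝ X y.2 u.2 := by
  rw [HasFDerivAt.fderiv (f := fun z : E × F => X z.2) (hX.hasFDerivAt.comp y hasFDerivAt_snd)]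
  rfl

variable [FiniteDimensional ℝ E] [FiniteDimensional ℝ F]
  {G : E → E →L[ℝ] E →L[ℝ] ℝ} {U : Set E} {G' : F → F →L[ℝ] F →L[ℝ] ℝ} {U' : Set F}

theorem IsMetricOn.prod (hG : IsMetricOn G U) (hG' : IsMetricOn G' U') :
    IsMetricOn (prodCoeff G G') (U ×ˢ U') where
  isOpen := hG.isOpen.prod hG'.isOpen
  symm y hy u v := by
    rw [prodCoeff_apply, prodCoeff_apply, hG.symm _ hy.1, hG'.symm _ hy.2]
  pos y hy := prodForm_pos (hG.pos _ hy.1) (hG'.pos _ hy.2)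
  smooth := by
    refine contDiffOn_clm_apply.2 fun u => contDiffOn_clm_apply.2 fun v => ?_
    have h1 : ContDiffOn ℝ ∞ (fun y : E × F => G y.1) (U ×ˢ U') :=
      hG.smooth.comp contDiffOn_fst fun y hy => hy.1
    have h2 : ContDiffOn ℝ ∞ (fun y : E × F => G' y.2) (U ×ˢ U') :=
      hG'.smooth.comp contDiffOn_snd fun y hy => hy.2
    exact ((h1.clm_apply contDiffOn_const).clm_apply contDiffOn_const).add
      ((h2.clm_apply contDiffOn_const).clm_apply contDiffOn_const)

theorem fderiv_prodCoeff (hG : IsMetricOn G U) (hG' : IsMetricOn G' U') {y : E × F}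
    (hy : y ∈ U ×ˢ U') (u v w : E × F) :
    fderiv ℝ (prodCoeff G G') y u v w
      = fderiv ℝ G y.1 u.1 v.1 w.1 + fderiv ℝ G' y.2 u.2 v.2 w.2 := by
  have hd := differentiableAt_of_contDiffOn (hG.prod hG').isOpen (hG.prod hG').smooth hy
  have h1 := differentiableAt_of_contDiffOn hG.isOpen hG.smooth hy.1
  have h2 := differentiableAt_of_contDiffOn hG'.isOpen hG'.smooth hy.2
  have e := fderiv_form_apply hd (differentiableAt_const v) w u
  have e1 := fderiv_form_apply h1 (differentiableAt_const v.1) w.1 u.1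
  have e2 := fderiv_form_apply h2 (differentiableAt_const v.2) w.2 u.2
  simp only [fderiv_const_apply, zero_apply, map_zero, add_zero] at e e1 e2
  have d1 : DifferentiableAt ℝ (fun z => G z v.1 w.1) y.1 :=
    (h1.clm_apply (differentiableAt_const _)).clm_apply (differentiableAt_const _)
  have d2 : DifferentiableAt ℝ (fun z => G' z v.2 w.2) y.2 :=
    (h2.clm_apply (differentiableAt_const _)).clm_apply (differentiableAt_const _)
  rw [← e, ← e1, ← e2, ← fderiv_comp_fst d1, ← fderiv_comp_snd d2, ← add_apply]
  refine DFunLike.congr_fun ?_ u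
  exact fderiv_fun_add (f := fun z : E × F => G z.1 v.1 w.1) (g := fun z : E × F => G' z.2 v.2 w.2)
    (d1.comp y differentiableAt_fst) (d2.comp y differentiableAt_snd)

theorem christoffel_prodCoeff (hG : IsMetricOn G U) (hG' : IsMetricOn G' U') {y : E × F}
    (hy : y ∈ U ×ˢ U') (u v : E × F) :
    christoffel (prodCoeff G G') y u v
      = (christoffel G y.1 u.1 v.1, christoffel G' y.2 u.2 v.2) := by
  refine eq_of_form_apply_eq ((hG.prod hG').pos y hy) fun w => ?_
  rw [(hG.prod hG').apply_christoffel hy, prodCoeff_apply, hG.apply_christoffel hy.1,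
    hG'.apply_christoffel hy.2]
  simp only [fderiv_prodCoeff hG hG' hy]
  ring

theorem curvature_prodCoeff (hG : IsMetricOn G U) (hG' : IsMetricOn G' U') {y : E × F}
    (hy : y ∈ U ×ˢ U') (v w : E × F) :
    curvature (prodCoeff G G') y v w
      = (curvature G y.1 v.1 w.1).prodMap (curvature G' y.2 v.2 w.2) := by
  have hP := hG.prod hG'
  have hd := differentiableAt_of_contDiffOn hP.isOpen hP.contDiffOn_christoffel hy
  have h1 := differentiableAt_of_contDiffOn hG.isOpen hG.contDiffOn_christoffel hy.1
  have h2 := differentiableAt_of_contDiffOn hG'.isOpen hG'.contDiffOn_christoffel hy.2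
  have key : ∀ a b c : E × F, fderiv ℝ (christoffel (prodCoeff G G')) y a b c
      = (fderiv ℝ (christoffel G) y.1 a.1 b.1 c.1, fderiv ℝ (christoffel G') y.2 a.2 b.2 c.2) := by
    intro a b c
    have e : (fun z => christoffel (prodCoeff G G') z b c) =ᶠ[nhds y]
        fun z => (christoffel G z.1 b.1 c.1, christoffel G' z.2 b.2 c.2) :=
      Filter.eventuallyEq_of_mem (hP.isOpen.mem_nhds hy)
        fun z hz => christoffel_prodCoeff hG hG' hz b c
    have f1 : HasFDerivAt (fun z : E × F => christoffel G z.1) _ y :=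
      h1.hasFDerivAt.comp y hasFDerivAt_fst
    have f2 : HasFDerivAt (fun z : E × F => christoffel G' z.2) _ y :=
      h2.hasFDerivAt.comp y hasFDerivAt_snd
    have g1 : HasFDerivAt (fun z : E × F => christoffel G z.1 b.1 c.1) _ y :=
      HasFDerivAt.clm_apply (c := fun z : E × F => christoffel G z.1 b.1)
        (f1.clm_apply (hasFDerivAt_const b.1 y)) (hasFDerivAt_const c.1 y)
    have g2 : HasFDerivAt (fun z : E × F => christoffel G' z.2 b.2 c.2) _ y :=
      HasFDerivAt.clm_apply (c := fun z : E × F => christoffel G' z.2 b.2)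
        (f2.clm_apply (hasFDerivAt_const b.2 y)) (hasFDerivAt_const c.2 y)
    have g : HasFDerivAt (fun z => christoffel (prodCoeff G G') z b c) _ y :=
      HasFDerivAt.clm_apply (c := fun z => christoffel (prodCoeff G G') z b)
        (hd.hasFDerivAt.clm_apply (hasFDerivAt_const b y)) (hasFDerivAt_const c y)
    have := DFunLike.congr_fun (e.fderiv_eq (𝕜 := ℝ)) a
    rw [g.fderiv, HasFDerivAt.fderiv (f := fun z : E × F =>
      (christoffel G z.1 b.1 c.1, christoffel G' z.2 b.2 c.2)) (g1.prodMk g2)] at this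
    simpa using this
  refine LinearMap.ext fun u => ?_
  simp only [curvature, LinearMap.coe_mk, AddHom.coe_mk, key, christoffel_prodCoeff hG hG' hy,
    LinearMap.prodMap_apply, Prod.mk_sub_mk, Prod.mk_add_mk]

theorem metricTrace_prodForm {b : E →L[ℝ] E →L[ℝ] ℝ} {c : F →L[ℝ] F →L[ℝ] ℝ}
    (hb : ∀ u, u ≠ 0 → 0 < b u u) (hc : ∀ u, u ≠ 0 → 0 < c u u)
    {T : (E × F) →ₗ[ℝ] (E × F) →ₗ[ℝ] ℝ} {S : E →ₗ[ℝ] E →ₗ[ℝ] ℝ} {S' : F →ₗ[ℝ] F →ₗ[ℝ] ℝ}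
    (hT : ∀ u v, T u v = S u.1 v.1 + S' u.2 v.2) :
    metricTrace (prodForm b c) T = metricTrace b S + metricTrace c S' := by
  simp only [metricTrace]
  rw [← LinearMap.trace_prodMap']
  congr 1
  refine LinearMap.ext fun u => ?_
  refine sharp_eq_of_apply_eq (prodForm_pos hb hc) fun w => ?_
  have h1 := DFunLike.congr_fun (apply_sharp hb (LinearMap.toContinuousLinearMap (S u.1))) w.1
  have h2 := DFunLike.congr_fun (apply_sharp hc (LinearMap.toContinuousLinearMap (S' u.2))) w.2
  exact (congrArg₂ (· + ·) h1 h2).trans (hT u w).symm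

theorem scal_prodCoeff (hG : IsMetricOn G U) (hG' : IsMetricOn G' U') {y : E × F}
    (hy : y ∈ U ×ˢ U') :
    scal (prodCoeff G G') y = scal G y.1 + scal G' y.2 := by
  refine metricTrace_prodForm (hG.pos _ hy.1) (hG'.pos _ hy.2) fun u v => ?_
  simp only [ricci, LinearMap.mk₂_apply]
  rw [curvature_prodCoeff hG hG' hy, LinearMap.trace_prodMap']

variable {h : E → ℝ} (hG : IsMetricOn G U) (hG' : IsMetricOn G' U') (hh : ContDiffOn ℝ ∞ h U)
include hG hG' hh

theorem gradient_comp_fst {y : E × F} (hy : y ∈ U ×ˢ U') :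
    gradient (prodCoeff G G') (fun z => h z.1) y = (gradient G h y.1, 0) := by
  refine sharp_eq_of_apply_eq ((hG.prod hG').pos y hy) fun w => ?_
  rw [fderiv_comp_fst (differentiableAt_of_contDiffOn hG.isOpen hh hy.1), prodCoeff_apply,
    hG.apply_gradient hy.1]
  simp

omit [FiniteDimensional ℝ E] [FiniteDimensional ℝ F] hG hG' in
theorem contDiffOn_comp_fst : ContDiffOn ℝ ∞ (fun z : E × F => h z.1) (U ×ˢ U') :=
  hh.comp contDiffOn_fst fun _ hy => hy.1

theorem covDeriv_gradient_comp_fst {y : E × F} (hy : y ∈ U ×ˢ U') (u : E × F) :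
    covDeriv (prodCoeff G G') (gradient (prodCoeff G G') (fun z => h z.1)) y u
      = (covDeriv G (gradient G h) y.1 u.1, 0) := by
  have hX := differentiableAt_of_contDiffOn hG.isOpen (hG.contDiffOn_gradient hh) hy.1
  have e : gradient (prodCoeff G G') (fun z => h z.1) =ᶠ[nhds y]
      fun z => (gradient G h z.1, (0 : F)) :=
    Filter.eventuallyEq_of_mem ((hG.prod hG').isOpen.mem_nhds hy)
      fun z hz => gradient_comp_fst hG hG' hh hz
  have f1 : HasFDerivAt (fun z : E × F => gradient G h z.1) _ y :=
    hX.hasFDerivAt.comp y hasFDerivAt_fst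
  rw [covDeriv_apply, e.fderiv_eq, gradient_comp_fst hG hG' hh hy,
    christoffel_prodCoeff hG hG' hy, HasFDerivAt.fderiv (f := fun z : E × F =>
      (gradient G h z.1, (0 : F))) (f1.prodMk (hasFDerivAt_const (0 : F) y))]
  simp [covDeriv_apply]

theorem laplacian_comp_fst {y : E × F} (hy : y ∈ U ×ˢ U') :
    laplacian (prodCoeff G G') (fun z => h z.1) y = laplacian G h y.1 := by
  rw [(hG.prod hG').laplacian_eq_neg_trace (contDiffOn_comp_fst hh) hy,
    hG.laplacian_eq_neg_trace hh hy.1]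
  congr 1
  have : (covDeriv (prodCoeff G G') (gradient (prodCoeff G G') fun z => h z.1) y).toLinearMap
      = (covDeriv G (gradient G h) y.1).toLinearMap.prodMap (0 : F →ₗ[ℝ] F) :=
    LinearMap.ext fun u => covDeriv_gradient_comp_fst hG hG' hh hy u
  rw [this, LinearMap.trace_prodMap', map_zero, add_zero]

omit hG hG' hh in
theorem IsKahlerOn.prod {J : E →L[ℝ] E} {J' : F →L[ℝ] F} (hG : IsKahlerOn J G U)
    (hG' : IsKahlerOn J' G' U') : IsKahlerOn (J.prodMap J') (prodCoeff G G') (U ×ˢ U') where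
  toIsMetricOn := hG.toIsMetricOn.prod hG'.toIsMetricOn
  J_sq u := Prod.ext (hG.J_sq u.1) (hG'.J_sq u.2)
  hermitian y hy u v := congrArg₂ (· + ·) (hG.hermitian _ hy.1 u.1 v.1)
    (hG'.hermitian _ hy.2 u.2 v.2)
  closed y hy u v w := by
    have h1 := hG.closed y.1 hy.1 u.1 v.1 w.1
    have h2 := hG'.closed y.2 hy.2 u.2 v.2 w.2
    simp only [fderiv_prodCoeff hG.toIsMetricOn hG'.toIsMetricOn hy,
      ContinuousLinearMap.coe_prodMap', Prod.map_fst, Prod.map_snd]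
    linarith

omit hG hG' in
/-- The pull-back of a Killing potential to a product is a Killing potential. -/
theorem isKillingPotentialOn_comp_fst {J : E →L[ℝ] E} {J' : F →L[ℝ] F} (hG : IsKahlerOn J G U)
    (hG' : IsKahlerOn J' G' U') (hK : IsKillingPotentialOn J G h U) :
    IsKillingPotentialOn (J.prodMap J') (prodCoeff G G') (fun z => h z.1) (U ×ˢ U') := by
  refine ((hG.prod hG').isKillingPotentialOn_iff (contDiffOn_comp_fst hh)).2 fun y hy u => ?_
  rw [covDeriv_gradient_comp_fst hG.toIsMetricOn hG'.toIsMetricOn hh hy,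
    covDeriv_gradient_comp_fst hG.toIsMetricOn hG'.toIsMetricOn hh hy]
  have := (hG.isKillingPotentialOn_iff hh).1 hK y.1 hy.1 u.1
  simp [this]

end Product

/-! ### Locality of the curvature, the Laplacian and the Killing condition -/

section Congr

variable {E : Type*} [NormedAddCommGroup E] [NormedSpace ℝ E]
  {G G' : E → E →L[ℝ] E →L[ℝ] ℝ} {h h' : E → ℝ} {y : E}

theorem christoffel_congr (hGG' : G =ᶠ[nhds y] G') : christoffel G y = christoffel G' y := by
  simp only [christoffel, christoffelFirst, hGG'.fderiv_eq, hGG'.eq_of_nhds]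

theorem scal_congr [FiniteDimensional ℝ E] (hGG' : G =ᶠ[nhds y] G') : scal G y = scal G' y := by
  have h1 : christoffel G =ᶠ[nhds y] christoffel G' :=
    hGG'.eventuallyEq_nhds.mono fun z hz => christoffel_congr hz
  have h2 : ∀ v w, curvature G y v w = curvature G' y v w := fun v w => LinearMap.ext fun u => by
    simp only [curvature, LinearMap.coe_mk, AddHom.coe_mk, h1.fderiv_eq, h1.eq_of_nhds]
  have h3 : ricci G y = ricci G' y := LinearMap.ext₂ fun v w => by
    simp only [ricci, LinearMap.mk₂_apply, h2]
  rw [scal, scal, h3, hGG'.eq_of_nhds]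

theorem laplacian_congr [FiniteDimensional ℝ E] (hGG' : G =ᶠ[nhds y] G') :
    laplacian G h y = laplacian G' h y := by
  simp only [laplacian, hessian, christoffel_congr hGG', hGG'.eq_of_nhds]

theorem IsKillingPotentialOn.congr {J : E →L[ℝ] E} {U : Set E} (hU : IsOpen U)
    (hGG' : Set.EqOn G G' U) (hhh' : Set.EqOn h h' U) (hK : IsKillingPotentialOn J G h U) :
    IsKillingPotentialOn J G' h' U := by
  have hX : Set.EqOn (gradient G h) (gradient G' h') U := fun z hz => by
    have e : h =ᶠ[nhds z] h' := Filter.eventuallyEq_of_mem (hU.mem_nhds hz) hhh'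
    rw [gradient, gradient, hGG' hz, e.fderiv_eq]
  intro y hy u v
  have e1 : G =ᶠ[nhds y] G' := Filter.eventuallyEq_of_mem (hU.mem_nhds hy) hGG'
  have e2 : (fun z => J (gradient G h z)) =ᶠ[nhds y] fun z => J (gradient G' h' z) :=
    Filter.eventuallyEq_of_mem (hU.mem_nhds hy) fun z hz => congrArg J (hX hz)
  rw [← e1.fderiv_eq, ← e2.fderiv_eq, ← hGG' hy, ← hX hy]
  exact hK y hy u v

end Congr

end LocalRiem

/-! ### Kähler metrics and Killing potentials in charts -/

namespace Kahler

section Charts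

variable {E : Type*} [NormedAddCommGroup E] [NormedSpace ℂ E] {H : Type*} [TopologicalSpace H]
  {I : ModelWithCorners ℂ E H} {M : Type*} [TopologicalSpace M] [ChartedSpace H M]

variable (I) in
/-- The derivative at `y` of the inverse of the chart `e.extend I`, with the tangent spaces
identified with `E`. -/
def chartDeriv (e : OpenPartialHomeomorph M H) (y : E) : E →L[ℂ] E :=
  mfderiv 𝓘(ℂ, E) I (e.extend I).symm y

variable (E) in
/-- The complex structure of a complex vector space, as a real linear map. -/
def complexStructure : E →L[ℝ] E := Complex.I • ContinuousLinearMap.id ℝ E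

theorem complexStructure_apply (u : E) : complexStructure E u = Complex.I • u := rfl

/-- The value at `x` of a field of bilinear forms, as a form on the model space `E`, with which
`TangentSpace I x` is definitionally equal. -/
def modelForm (T : BilinField I M) (x : M) : E →L[ℝ] E →L[ℝ] ℝ := T x

theorem coordBilin_apply (T : BilinField I M) (e : OpenPartialHomeomorph M H) (y u v : E) :
    coordBilin T e y u v
      = modelForm T ((e.extend I).symm y) (chartDeriv I e y u) (chartDeriv I e y v) := rfl

theorem coordBilin_kahlerForm (g : BilinField I M) (e : OpenPartialHomeomorph M H) (y : E) :
    coordBilin (kahlerForm g) e y = (coordBilin g e y).comp (complexStructure E) := by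
  ext u v
  rw [coordBilin_apply, ContinuousLinearMap.comp_apply, coordBilin_apply, complexStructure_apply,
    map_smul]
  rfl

theorem chartDeriv_smul_I (e : OpenPartialHomeomorph M H) (y u : E) :
    chartDeriv I e y (complexStructure E u) = complexStructure E (chartDeriv I e y u) :=
  map_smul _ _ _

theorem fderiv_coordBilin_kahlerForm {g : BilinField I M} {e : OpenPartialHomeomorph M H} {y : E}
    (hd : DifferentiableAt ℝ (coordBilin g e) y) (u v w : E) :
    fderiv ℝ (coordBilin (kahlerForm g) e) y u v w
      = fderiv ℝ (coordBilin g e) y u (complexStructure E v) w := by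
  rw [funext (coordBilin_kahlerForm g e), HasFDerivAt.fderiv
    (f := fun z => (coordBilin g e z).comp (complexStructure E))
    (hd.hasFDerivAt.clm_comp (hasFDerivAt_const (complexStructure E) y))]
  simp

variable [I.Boundaryless] [IsManifold I ω M] {e : OpenPartialHomeomorph M H}

theorem mdifferentiableAt_extend_symm (he : e ∈ atlas H M) {y : E} (hy : y ∈ (e.extend I).target) :
    MDifferentiableAt 𝓘(ℂ, E) I (e.extend I).symm y := by
  have h := contMDiffOn_extend_symm (I := I) (n := ω) (IsManifold.subset_maximalAtlas he)
  rw [← OpenPartialHomeomorph.extend_target'] at h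
  exact (h.contMDiffAt (e.isOpen_extend_target.mem_nhds hy)).mdifferentiableAt (by simp)

omit [I.Boundaryless] in
theorem mdifferentiableAt_extend (he : e ∈ atlas H M) {x : M} (hx : x ∈ e.source) :
    MDifferentiableAt I 𝓘(ℂ, E) (e.extend I) x :=
  (OpenPartialHomeomorph.contMDiffAt_extend (n := ω) (IsManifold.subset_maximalAtlas he)
    hx).mdifferentiableAt (by simp)

omit [ChartedSpace H M] [I.Boundaryless] [IsManifold I ω M] in
theorem extend_symm_mem_source {y : E} (hy : y ∈ (e.extend I).target) :
    (e.extend I).symm y ∈ e.source := by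
  rw [← e.extend_source (I := I)]
  exact (e.extend I).map_target hy

theorem mfderiv_extend_chartDeriv (he : e ∈ atlas H M) {y : E} (hy : y ∈ (e.extend I).target)
    (u : E) : (mfderiv I 𝓘(ℂ, E) (e.extend I) ((e.extend I).symm y) : E →L[ℂ] E)
      (chartDeriv I e y u) = u := by
  have h := mfderiv_comp y (mdifferentiableAt_extend he (extend_symm_mem_source hy))
    (mdifferentiableAt_extend_symm he hy)
  have e1 : (e.extend I) ∘ (e.extend I).symm =ᶠ[nhds y] id :=
    Filter.eventuallyEq_of_mem (e.isOpen_extend_target.mem_nhds hy)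
      fun z hz => (e.extend I).right_inv hz
  rw [e1.mfderiv_eq, mfderiv_id] at h
  exact (DFunLike.congr_fun h u).symm

theorem chartDeriv_injective (he : e ∈ atlas H M) {y : E} (hy : y ∈ (e.extend I).target) :
    Function.Injective (chartDeriv I e y) :=
  Function.LeftInverse.injective (mfderiv_extend_chartDeriv he hy)

theorem chartDeriv_surjective [FiniteDimensional ℂ E] (he : e ∈ atlas H M) {y : E}
    (hy : y ∈ (e.extend I).target) : Function.Surjective (chartDeriv I e y) :=
  (LinearMap.injective_iff_surjective (f := (chartDeriv I e y : E →ₗ[ℂ] E))).1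
    (chartDeriv_injective he hy)

theorem hasFDerivAt_chartDeriv (he : e ∈ atlas H M) {y : E} (hy : y ∈ (e.extend I).target) :
    HasFDerivAt (extChartAt I ((e.extend I).symm y) ∘ (e.extend I).symm) (chartDeriv I e y) y := by
  have h : HasFDerivWithinAt (extChartAt I ((e.extend I).symm y) ∘ (e.extend I).symm)
      (chartDeriv I e y) (Set.range 𝓘(ℂ, E)) y :=
    (mdifferentiableAt_extend_symm he hy).hasMFDerivAt.2
  rwa [modelWithCornersSelf_coe, Set.range_id, hasFDerivWithinAt_univ] at h

/-- The differential of a function, in the coordinates of an arbitrary chart. -/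
theorem fderiv_coordFun {h : M → ℝ}
    (hh : ∀ e ∈ atlas H M, ContDiffOn ℝ ∞ (coordFun I h e) (e.extend I).target)
    (he : e ∈ atlas H M) {y : E} (hy : y ∈ (e.extend I).target) (u : E) :
    fderiv ℝ (coordFun I h e) y u
      = (differential (I := I) h ((e.extend I).symm y) : E →L[ℝ] ℝ) (chartDeriv I e y u) := by
  set x := (e.extend I).symm y with hx
  have hmem : extChartAt I x x ∈ ((chartAt H x).extend I).target := mem_extChartAt_target x
  have h1 : DifferentiableAt ℝ (coordFun I h (chartAt H x)) (extChartAt I x x) :=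
    LocalRiem.differentiableAt_of_contDiffOn (chartAt H x).isOpen_extend_target
      (hh _ (chart_mem_atlas H x)) hmem
  have h2 := (hasFDerivAt_chartDeriv he hy).restrictScalars ℝ
  have e1 : coordFun I h e =ᶠ[nhds y]
      coordFun I h (chartAt H x) ∘ (extChartAt I x ∘ (e.extend I).symm) := by
    have hc : ContinuousAt (e.extend I).symm y :=
      (mdifferentiableAt_extend_symm he hy).continuousAt
    filter_upwards [hc.preimage_mem_nhds (extChartAt_source_mem_nhds (I := I) x)] with z hz
    exact congrArg h ((extChartAt I x).left_inv hz).symm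
  rw [e1.fderiv_eq, (h1.hasFDerivAt.comp y h2).fderiv]
  rfl

variable [FiniteDimensional ℂ E] {g : BilinField I M}

omit [FiniteDimensional ℂ E] in
theorem coordBilin_pos (hpos : ∀ (x : M) (u : TangentSpace I x), u ≠ 0 → 0 < g x u u)
    (he : e ∈ atlas H M) {y : E} (hy : y ∈ (e.extend I).target) (u : E) (hu : u ≠ 0) :
    0 < coordBilin g e y u u := by
  rw [coordBilin_apply]
  exact hpos _ _ fun h0 => hu (chartDeriv_injective he hy (h0.trans (map_zero _).symm))

omit [FiniteDimensional ℂ E] in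
theorem IsKahler.isKahlerOn (hg : IsKahler g) (he : e ∈ atlas H M) :
    LocalRiem.IsKahlerOn (complexStructure E) (coordBilin g e) (e.extend I).target where
  isOpen := e.isOpen_extend_target
  symm y _ u v := by
    rw [coordBilin_apply, coordBilin_apply]
    exact hg.symm _ _ _
  pos y hy := coordBilin_pos hg.pos he hy
  smooth := hg.smooth e he
  J_sq u := by
    rw [complexStructure_apply, complexStructure_apply, smul_smul, Complex.I_mul_I, neg_one_smul]
  hermitian y _ u v := by
    rw [coordBilin_apply, coordBilin_apply, chartDeriv_smul_I, chartDeriv_smul_I]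
    exact hg.hermitian _ _ _
  closed y hy u v w := by
    have hd := LocalRiem.differentiableAt_of_contDiffOn e.isOpen_extend_target (hg.smooth e he) hy
    have h := hg.closed e he y hy u v w
    simpa only [fderiv_coordBilin_kahlerForm hd] using h

/-- The gradient of a function, in the coordinates of an arbitrary chart. -/
theorem grad_eq_chartDeriv (hg : IsKahler g) {h : M → ℝ}
    (hh : ∀ e ∈ atlas H M, ContDiffOn ℝ ∞ (coordFun I h e) (e.extend I).target)
    (he : e ∈ atlas H M) {y : E} (hy : y ∈ (e.extend I).target) :
    grad g h ((e.extend I).symm y)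
      = chartDeriv I e y (LocalRiem.gradient (coordBilin g e) (coordFun I h e) y) := by
  refine LocalRiem.sharp_eq_of_apply_eq (b := modelForm g _) (hg.pos _) fun w => ?_
  obtain ⟨w, rfl⟩ := chartDeriv_surjective he hy w
  rw [← coordBilin_apply, (hg.isKahlerOn he).apply_gradient hy, fderiv_coordFun hh he hy]
  rfl

/-- The components of `J grad h`, in the coordinates of an arbitrary chart. -/
theorem coordVec_J_grad (hg : IsKahler g) {h : M → ℝ}
    (hh : ∀ e ∈ atlas H M, ContDiffOn ℝ ∞ (coordFun I h e) (e.extend I).target)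
    (he : e ∈ atlas H M) {y : E} (hy : y ∈ (e.extend I).target) :
    coordVec (fun x => J x (grad g h x)) e y
      = complexStructure E (LocalRiem.gradient (coordBilin g e) (coordFun I h e) y) := by
  have h1 : J ((e.extend I).symm y) (grad g h ((e.extend I).symm y)) = chartDeriv I e y
      (complexStructure E (LocalRiem.gradient (coordBilin g e) (coordFun I h e) y)) := by
    rw [chartDeriv_smul_I, grad_eq_chartDeriv hg hh he hy]
    rfl
  rw [coordVec, h1]
  exact mfderiv_extend_chartDeriv he hy _

/-- Killing potentials, in terms of the coefficients in all charts. -/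
theorem isKillingPotential_iff (hg : IsKahler g) {h : M → ℝ} :
    IsKillingPotential g h ↔ ∀ e ∈ atlas H M,
      ContDiffOn ℝ ∞ (coordFun I h e) (e.extend I).target ∧
      LocalRiem.IsKillingPotentialOn (complexStructure E) (coordBilin g e) (coordFun I h e)
        (e.extend I).target := by
  have key : ∀ e ∈ atlas H M,
      (∀ e ∈ atlas H M, ContDiffOn ℝ ∞ (coordFun I h e) (e.extend I).target) →
      ∀ y ∈ (e.extend I).target, fderiv ℝ (coordVec (fun x => J x (grad g h x)) e) y
        = fderiv ℝ (fun z => complexStructure E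
          (LocalRiem.gradient (coordBilin g e) (coordFun I h e) z)) y := fun e he hh y hy =>
    (Filter.eventuallyEq_of_mem (e.isOpen_extend_target.mem_nhds hy)
      fun z hz => coordVec_J_grad hg hh he hz).fderiv_eq
  refine ⟨fun H e he => ⟨H.smooth e he, fun y hy u v => ?_⟩, fun H => ?_⟩
  · have := H.killing.lie_eq_zero e he y hy u v
    rwa [key e he H.smooth y hy, coordVec_J_grad hg H.smooth he hy] at this
  · have hh := fun e he => (H e he).1
    refine ⟨hh, fun e he => ?_, fun e he y hy u v => ?_⟩
    · have h1 := (hg.isKahlerOn he).contDiffOn_gradient (hh e he)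
      exact ((complexStructure E).contDiff.comp_contDiffOn h1).congr
        fun y hy => coordVec_J_grad hg hh he hy
    · rw [key e he hh y hy, coordVec_J_grad hg hh he hy]
      exact (H e he).2 y hy u v

/-- `|dh|²`, in the coordinates of an arbitrary chart. -/
theorem normSqDifferential_eq (hg : IsKahler g) {h : M → ℝ}
    (hh : ∀ e ∈ atlas H M, ContDiffOn ℝ ∞ (coordFun I h e) (e.extend I).target)
    (he : e ∈ atlas H M) {y : E} (hy : y ∈ (e.extend I).target) :
    normSqDifferential g h ((e.extend I).symm y) = fderiv ℝ (coordFun I h e) y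
      (LocalRiem.gradient (coordBilin g e) (coordFun I h e) y) := by
  rw [normSqDifferential, grad_eq_chartDeriv hg hh he hy, fderiv_coordFun hh he hy]

/-- The Laplacian, in the coordinates of an arbitrary chart. -/
theorem laplacian_eq (hg : IsKahler g) {h : M → ℝ}
    (hh : ∀ e ∈ atlas H M, ContDiffOn ℝ ∞ (coordFun I h e) (e.extend I).target)
    (he : e ∈ atlas H M) {y : E} (hy : y ∈ (e.extend I).target) :
    laplacian g h ((e.extend I).symm y)
      = LocalRiem.laplacian (coordBilin g e) (coordFun I h e) y := by
  set x := (e.extend I).symm y with hx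
  set e' := chartAt H x
  have he' : e' ∈ atlas H M := chart_mem_atlas H x
  set φ : E → E := e'.extend I ∘ (e.extend I).symm
  set W := ((e.extend I).symm.trans (e'.extend I)).source
  have hWe : ∀ z ∈ W, z ∈ (e.extend I).target ∧ (e.extend I).symm z ∈ (e'.extend I).source :=
    fun z hz => ⟨hz.1, hz.2⟩
  have hcont : ContinuousOn (e.extend I).symm (e.extend I).target := fun z hz =>
    (mdifferentiableAt_extend_symm he hz).continuousAt.continuousWithinAt
  have hW : IsOpen W := hcont.isOpen_inter_preimage e.isOpen_extend_target e'.isOpen_extend_source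
  have hφc : ContDiffOn ℂ ω φ W := I.contDiffOn_extendCoordChange
    (IsManifold.subset_maximalAtlas he) (IsManifold.subset_maximalAtlas he')
  have hφ : ContDiffOn ℝ ∞ φ W := (hφc.restrict_scalars ℝ).of_le le_top
  have hinv : ∀ z ∈ W, (e.extend I).symm z = (e'.extend I).symm (φ z) := fun z hz =>
    ((e'.extend I).left_inv (hWe z hz).2).symm
  have hφW : Set.MapsTo φ W (e'.extend I).target := fun z hz =>
    (e'.extend I).map_source (hWe z hz).2
  -- The chain rule for the inverses of the charts.
  have hL : ∀ z ∈ W, ∀ u, chartDeriv I e z u = chartDeriv I e' (φ z) (fderiv ℝ φ z u) := by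
    intro z hz u
    have hd : DifferentiableAt ℂ φ z :=
      (hφc.contDiffAt (hW.mem_nhds hz)).differentiableAt (by simp)
    have h1 : (e.extend I).symm =ᶠ[nhds z] (e'.extend I).symm ∘ φ :=
      Filter.eventuallyEq_of_mem (hW.mem_nhds hz) hinv
    have h2 := (h1.mfderiv_eq (I := 𝓘(ℂ, E)) (I' := I)).trans
      (mfderiv_comp z (mdifferentiableAt_extend_symm he' (hφW hz)) hd.mdifferentiableAt)
    rw [mfderiv_eq_fderiv] at h2
    rw [hd.fderiv_restrictScalars ℝ]
    exact DFunLike.congr_fun h2 u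
  have hyW : y ∈ W := by
    refine ⟨hy, ?_⟩
    rw [Set.mem_preimage, e'.extend_source]
    exact mem_chart_source H x
  refine (LocalRiem.laplacian_comp (hg.isKahlerOn he).toIsMetricOn
    (hg.isKahlerOn he').toIsMetricOn (hh e he) (hh e' he') hW (fun z hz => (hWe z hz).1) hφW hφ
    (fun z hz u v => ?_) (fun z hz => ?_) hyW).symm
  · rw [coordBilin_apply, coordBilin_apply, ← hL z hz, ← hL z hz, hinv z hz]
  · exact congrArg h (hinv z hz)

end Charts

/-! ### Kähler products -/

section Product

open LocalRiem (prodCoeff)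

variable {E : Type*} [NormedAddCommGroup E] [NormedSpace ℂ E]
  {F : Type*} [NormedAddCommGroup F] [NormedSpace ℂ F]
  {H : Type*} [TopologicalSpace H] {K : Type*} [TopologicalSpace K]
  {I : ModelWithCorners ℂ E H} {I' : ModelWithCorners ℂ F K} [I.Boundaryless] [I'.Boundaryless]
  {M : Type*} [TopologicalSpace M] [ChartedSpace H M] [IsManifold I ω M]
  {N : Type*} [TopologicalSpace N] [ChartedSpace K N] [IsManifold I' ω N]

theorem chartDeriv_prod {e : OpenPartialHomeomorph M H} (he : e ∈ atlas H M)
    {e' : OpenPartialHomeomorph N K} (he' : e' ∈ atlas K N) {y : E × F}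
    (hy : y ∈ (e.extend I).target ×ˢ (e'.extend I').target) :
    chartDeriv (I.prod I') (e.prod e') y
      = (chartDeriv I e y.1).prodMap (chartDeriv I' e' y.2) := by
  have hP : e.prod e' ∈ atlas (ModelProd H K) (M × N) := Set.mem_image2_of_mem he he'
  have hy' : y ∈ ((e.prod e').extend (I.prod I')).target := by
    rwa [OpenPartialHomeomorph.extend_prod]
  have h := hasFDerivAt_chartDeriv hP hy'
  rw [OpenPartialHomeomorph.extend_prod, extChartAt_prod] at h
  exact h.unique ((hasFDerivAt_chartDeriv he hy.1).prodMap y (hasFDerivAt_chartDeriv he' hy.2))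

theorem coordBilin_prodMetric (g : BilinField I M) (g' : BilinField I' N)
    {e : OpenPartialHomeomorph M H} (he : e ∈ atlas H M)
    {e' : OpenPartialHomeomorph N K} (he' : e' ∈ atlas K N) {y : E × F}
    (hy : y ∈ (e.extend I).target ×ˢ (e'.extend I').target) :
    coordBilin (prodMetric g g') (e.prod e') y
      = prodCoeff (coordBilin g e) (coordBilin g' e') y := by
  refine ContinuousLinearMap.ext fun u => ContinuousLinearMap.ext fun v => ?_
  rw [coordBilin_apply, chartDeriv_prod he he' hy, OpenPartialHomeomorph.extend_prod]
  rfl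

theorem coordBilin_prodMetric_eventuallyEq (g : BilinField I M) (g' : BilinField I' N)
    (p : M × N) :
    coordBilin (prodMetric g g') (chartAt (ModelProd H K) p)
      =ᶠ[nhds (extChartAt (I.prod I') p p)]
        LocalRiem.prodCoeff (coordBilin g (chartAt H p.1)) (coordBilin g' (chartAt K p.2)) := by
  refine Filter.eventuallyEq_of_mem (((chartAt H p.1).isOpen_extend_target (I := I)).prod
    ((chartAt K p.2).isOpen_extend_target (I := I')) |>.mem_nhds
    ⟨mem_extChartAt_target p.1, mem_extChartAt_target p.2⟩) fun z hz => ?_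
  exact coordBilin_prodMetric g g' (chart_mem_atlas H p.1) (chart_mem_atlas K p.2) hz

omit [I.Boundaryless] [I'.Boundaryless] [ChartedSpace H M] [IsManifold I ω M] [ChartedSpace K N]
  [IsManifold I' ω N] in
theorem coordFun_comp_fst (h : M → ℝ) (e : OpenPartialHomeomorph M H)
    (e' : OpenPartialHomeomorph N K) :
    coordFun (I.prod I') (fun p : M × N => h p.1) (e.prod e') = fun y => coordFun I h e y.1 := by
  funext y
  rw [coordFun, OpenPartialHomeomorph.extend_prod]
  rfl

end Product

end Kahler

namespace Kahler

section Product

variable {E : Type*} [NormedAddCommGroup E] [NormedSpace ℂ E] [FiniteDimensional ℂ E]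
  {F : Type*} [NormedAddCommGroup F] [NormedSpace ℂ F] [FiniteDimensional ℂ F]
  {H : Type*} [TopologicalSpace H] {K : Type*} [TopologicalSpace K]
  {I : ModelWithCorners ℂ E H} {I' : ModelWithCorners ℂ F K} [I.Boundaryless] [I'.Boundaryless]
  {M : Type*} [TopologicalSpace M] [ChartedSpace H M] [IsManifold I ω M]
  {N : Type*} [TopologicalSpace N] [ChartedSpace K N] [IsManifold I' ω N]
  {g : BilinField I M} {g' : BilinField I' N}

theorem IsKahler.prod (hg : IsKahler g) (hg' : IsKahler g') : IsKahler (prodMetric g g') where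
  symm p u v := congrArg₂ (· + ·) (hg.symm p.1 u.1 v.1) (hg'.symm p.2 u.2 v.2)
  pos p := LocalRiem.prodForm_pos (b := modelForm g p.1) (c := modelForm g' p.2) (hg.pos p.1)
    (hg'.pos p.2)
  hermitian p u v := congrArg₂ (· + ·) (hg.hermitian p.1 u.1 v.1) (hg'.hermitian p.2 u.2 v.2)
  smooth := by
    rintro _ ⟨e, he, e', he', rfl⟩
    rw [OpenPartialHomeomorph.extend_prod]
    exact ((hg.isKahlerOn he).prod (hg'.isKahlerOn he')).smooth.congr
      fun y hy => coordBilin_prodMetric g g' he he' hy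
  closed := by
    rintro _ ⟨e, he, e', he', rfl⟩ y hy u v w
    rw [OpenPartialHomeomorph.extend_prod] at hy
    have hP := (hg.isKahlerOn he).prod (hg'.isKahlerOn he')
    have h1 : coordBilin (prodMetric g g') (e.prod e')
        =ᶠ[nhds y] LocalRiem.prodCoeff (coordBilin g e) (coordBilin g' e') :=
      Filter.eventuallyEq_of_mem (hP.isOpen.mem_nhds hy)
        fun z hz => coordBilin_prodMetric g g' he he' hz
    have hd :=
      (LocalRiem.differentiableAt_of_contDiffOn hP.isOpen hP.smooth hy).congr_of_eventuallyEq h1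
    simp only [fderiv_coordBilin_kahlerForm hd, h1.fderiv_eq]
    exact hP.closed y hy u v w

/-- The pull-back of a Killing potential to a Kähler product is a Killing potential. -/
theorem IsKillingPotential.comp_fst (hg : IsKahler g) (hg' : IsKahler g') {h : M → ℝ}
    (hh : IsKillingPotential g h) :
    IsKillingPotential (prodMetric g g') (fun p : M × N => h p.1) := by
  refine (isKillingPotential_iff (hg.prod hg')).2 ?_
  rintro _ ⟨e, he, e', he', rfl⟩
  rw [OpenPartialHomeomorph.extend_prod, coordFun_comp_fst]
  obtain ⟨h1, h2⟩ := (isKillingPotential_iff hg).1 hh e he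
  refine ⟨LocalRiem.contDiffOn_comp_fst h1, ?_⟩
  exact (LocalRiem.isKillingPotentialOn_comp_fst h1 (hg.isKahlerOn he) (hg'.isKahlerOn he')
    h2).congr (e.isOpen_extend_target.prod e'.isOpen_extend_target)
    (fun y hy => (coordBilin_prodMetric g g' he he' hy).symm) fun _ _ => rfl

theorem scalarCurvature_prodMetric (hg : IsKahler g) (hg' : IsKahler g') (p : M × N) :
    scalarCurvature (prodMetric g g') p = scalarCurvature g p.1 + scalarCurvature g' p.2 := by
  rw [scalarCurvature, LocalRiem.scal_congr (coordBilin_prodMetric_eventuallyEq g g' p)]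
  exact LocalRiem.scal_prodCoeff (hg.isKahlerOn (chart_mem_atlas H p.1)).toIsMetricOn
    (hg'.isKahlerOn (chart_mem_atlas K p.2)).toIsMetricOn
    ⟨mem_extChartAt_target p.1, mem_extChartAt_target p.2⟩

theorem laplacian_comp_fst (hg : IsKahler g) (hg' : IsKahler g') {h : M → ℝ}
    (hh : ∀ e ∈ atlas H M, ContDiffOn ℝ ∞ (coordFun I h e) (e.extend I).target) (p : M × N) :
    laplacian (prodMetric g g') (fun p : M × N => h p.1) p = laplacian g h p.1 := by
  rw [laplacian, LocalRiem.laplacian_congr (coordBilin_prodMetric_eventuallyEq g g' p),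
    prodChartedSpace_chartAt, coordFun_comp_fst]
  exact LocalRiem.laplacian_comp_fst (hg.isKahlerOn (chart_mem_atlas H p.1)).toIsMetricOn
    (hg'.isKahlerOn (chart_mem_atlas K p.2)).toIsMetricOn (hh _ (chart_mem_atlas H p.1))
    ⟨mem_extChartAt_target p.1, mem_extChartAt_target p.2⟩

omit [FiniteDimensional ℂ E] [FiniteDimensional ℂ F] [I'.Boundaryless] [IsManifold I ω M]
  [IsManifold I' ω N] in
theorem differential_comp_fst {h : M → ℝ}
    (hh : ∀ e ∈ atlas H M, ContDiffOn ℝ ∞ (coordFun I h e) (e.extend I).target) (p : M × N)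
    (u : E × F) :
    (differential (I := I.prod I') (fun p : M × N => h p.1) p : E × F →L[ℝ] ℝ) u
      = (differential (I := I) h p.1 : E →L[ℝ] ℝ) u.1 := by
  have h1 := LocalRiem.differentiableAt_of_contDiffOn
    (chartAt H p.1).isOpen_extend_target (hh _ (chart_mem_atlas H p.1))
    (mem_extChartAt_target (I := I) p.1)
  rw [differential, prodChartedSpace_chartAt, coordFun_comp_fst]
  exact LocalRiem.fderiv_comp_fst (y := extChartAt (I.prod I') p p) h1 u

theorem normSqDifferential_comp_fst (hg : IsKahler g) (hg' : IsKahler g') {h : M → ℝ}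
    (hh : ∀ e ∈ atlas H M, ContDiffOn ℝ ∞ (coordFun I h e) (e.extend I).target) (p : M × N) :
    normSqDifferential (prodMetric g g') (fun p : M × N => h p.1) p
      = normSqDifferential g h p.1 := by
  have h1 : (grad (prodMetric g g') (fun p : M × N => h p.1) p : E × F) = (grad g h p.1, 0) := by
    refine LocalRiem.sharp_eq_of_apply_eq (b := modelForm (prodMetric g g') p)
      ((hg.prod hg').pos p) fun w => ?_
    refine Eq.trans ?_ (differential_comp_fst hh p w).symm
    have h2 := DFunLike.congr_fun (LocalRiem.apply_sharp (b := modelForm g p.1) (hg.pos p.1)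
      (differential (I := I) h p.1)) w.1
    refine Eq.trans ?_ h2
    change modelForm g p.1 _ w.1 + modelForm g' p.2 0 w.2 = _
    rw [map_zero, zero_apply, add_zero]
    rfl
  rw [normSqDifferential, normSqDifferential]
  refine (differential_comp_fst hh p _).trans ?_
  exact congrArg (fun u : E × F => (differential (I := I) h p.1 : E →L[ℝ] ℝ) u.1) h1

end Product

/-! ### Flat Kähler metrics -/

section Flat

variable {E : Type*} [NormedAddCommGroup E] [NormedSpace ℂ E] [FiniteDimensional ℂ E]
  {H : Type*} [TopologicalSpace H] {I : ModelWithCorners ℂ E H} [I.Boundaryless]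
  {M : Type*} [TopologicalSpace M] [ChartedSpace H M] [IsManifold I ω M] {g : BilinField I M}

omit [I.Boundaryless] [IsManifold I ω M] in
theorem IsFlat.isScalarFlat (hg : IsFlat g) : IsScalarFlat g := fun x => by
  have h1 : LocalRiem.ricci (coordBilin g (chartAt H x)) (extChartAt I x x) = 0 :=
    LinearMap.ext₂ fun v w => by
      have h2 : LocalRiem.curvature (coordBilin g (chartAt H x)) (extChartAt I x x) v w = 0 :=
        LinearMap.ext fun u =>
          hg _ (chart_mem_atlas H x) _ (mem_extChartAt_target x) u v w
      rw [LocalRiem.ricci, LinearMap.mk₂_apply, h2, map_zero]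
      rfl
  rw [scalarCurvature, LocalRiem.scal, h1, LocalRiem.metricTrace, LinearMap.comp_zero,
    LinearMap.comp_zero, map_zero]

/-- On a flat Kähler manifold, `h Δ h` and `|dh|²` are Killing potentials for every Killing
potential `h`. -/
theorem IsKillingPotential.laplacian_add_normSq (hg : IsKahler g) (hflat : IsFlat g) {h : M → ℝ}
    (hh : IsKillingPotential g h) (a b : ℝ) :
    IsKillingPotential g
      (fun x => a * (h x * laplacian g h x) + b * normSqDifferential g h x) := by
  refine (isKillingPotential_iff hg).2 fun e he => ?_
  obtain ⟨hs, hK⟩ := (isKillingPotential_iff hg).1 hh e he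
  have hG := hg.isKahlerOn he
  have heq : Set.EqOn (fun y => a * (coordFun I h e y
        * LocalRiem.laplacian (coordBilin g e) (coordFun I h e) y)
      + b * fderiv ℝ (coordFun I h e) y
        (LocalRiem.gradient (coordBilin g e) (coordFun I h e) y))
      (coordFun I (fun x => a * (h x * laplacian g h x) + b * normSqDifferential g h x) e)
      (e.extend I).target := fun y hy => by
    simp only [coordFun]
    rw [laplacian_eq hg hh.smooth he hy, normSqDifferential_eq hg hh.smooth he hy]
  refine ⟨ContDiffOn.congr ?_ heq.symm, ?_⟩
  · exact (contDiffOn_const.mul (hs.mul (hG.contDiffOn_laplacian hs))).add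
      (contDiffOn_const.mul (hG.contDiffOn_fderiv_gradient hs))
  · exact (hG.isKillingPotentialOn_laplacian_add (hflat e he) hs hK a b).congr
      e.isOpen_extend_target (fun _ _ => rfl) heq

end Flat

end Kahler

end

theorem mainTheorem8
    {E : Type*} [NormedAddCommGroup E] [NormedSpace ℂ E] [FiniteDimensional ℂ E]
    {F : Type*} [NormedAddCommGroup F] [NormedSpace ℂ F] [FiniteDimensional ℂ F]
    {V : Type*} [TopologicalSpace V] [ChartedSpace E V] [IsManifold 𝓘(ℂ, E) ω V]
    {B : Type*} [TopologicalSpace B] [ChartedSpace F B] [IsManifold 𝓘(ℂ, F) ω B]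
    (gV : Kahler.BilinField 𝓘(ℂ, E) V) (hV : Kahler.IsKahler gV) (hVflat : Kahler.IsFlat gV)
    (f : V → ℝ) (hfpos : ∀ x, 0 < f x) (hf : Kahler.IsKillingPotential gV f)
    (gB : Kahler.BilinField 𝓘(ℂ, F) B) (hB : Kahler.IsKahler gB)
    (hBscal : Kahler.IsScalarFlat gB) (ν : ℝ) :
    Kahler.IsWeightedExtremal (Kahler.prodMetric gV gB) (fun p : V × B => f p.1) ν := by
  refine ⟨hV.prod hB, hf.comp_fst hV hB, ?_⟩
  have h : Kahler.weightedScalarCurvature (Kahler.prodMetric gV gB) (fun p : V × B => f p.1) ν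
      = fun p => -2 * (ν - 1) * (f p.1 * Kahler.laplacian gV f p.1)
        + -ν * (ν - 1) * Kahler.normSqDifferential gV f p.1 := by
    funext p
    rw [Kahler.weightedScalarCurvature, Kahler.scalarCurvature_prodMetric hV hB,
      hVflat.isScalarFlat, hBscal, Kahler.laplacian_comp_fst hV hB hf.smooth,
      Kahler.normSqDifferential_comp_fst hV hB hf.smooth]
    ring
  rw [h]
  exact (hf.laplacian_add_normSq hV hVflat _ _).comp_fst hV hB
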